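/- Let $m\ge 0$, let $\tau_1<\dots<\tau_m$ and $s_1,\dots,s_m$ be real numbers, and let $\mathcal H=L^2(\{\tau_1,\dots,\tau_m\}\times\mathbb R;\mathbb C)$ with respect to counting measure times Lebesgue measure. Let $\chi_s(\tau_k,x)=\mathbf 1(x>s_k)$. For real $\tau_i,s_i$ put $\tilde s_i=s_i-\min\{0,\tau_i\}^2$, $\hat s_i=s_i+\max\{0,\tau_i\}^2$, and $$G(\tau_1,s_1;\tau_2,s_2)=-\frac{1}{\sqrt{4\pi(\tau_2-\tau_1)}}\exp\Big(-\frac{(\tilde s_2-\tilde s_1)^2}{4(\tau_2-\tau_1)}\Big)\mathbf 1(\tau_2>\tau_1).$$ Let $K_\infty$ be the Airy$_{2\to1}$ transition kernel in one of the following two forms. (a) Contour form: $$K_\infty(\tau_1,s_1;\tau_2,s_2)=G(\tau_1,s_1;\tau_2,s_2)+\frac{1}{(2\pi i)^2}\int_{\gamma_+}dw\int_{\gamma_-}dz\,\frac{e^{w^3/3+\tau_2w^2-\tilde s_2w}}{e^{z^3/3+\tau_1z^2-\tilde s_1z}}\,\frac{2w}{(z-w)(z+w)},$$ where $\gamma_+$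 is the broken line from $e^{i\phi_+}\infty$ to $e^{-i\phi_+}\infty$ with apex $a$, and $\gamma_-$ the broken line from $e^{-i\phi_-}\infty$ to $e^{i\phi_-}\infty$ with apex $b$, for any choice of $\phi_+\in(\pi/3,\pi/2)$, $\phi_-\in(\pi/2,\pi-\phi_+)$ and real $a,b$ with $-a<b<a$ (so that $\gamma_-$ separates $-\gamma_+$ from $\gamma_+$). (b) Airy form: $K_\infty=K_0+K_1+K_2$ with $$K_0(\tau_1,s_1;\tau_2,s_2)=\Big(\frac{e^{\frac23\tau_2^3+\tau_2\tilde s_2}}{e^{\frac23\tau_1^3+\tau_1\tilde s_1}}\Big)^{\sigma}G(\tau_1,s_1;\tau_2,s_2),$$ $$K_1(\tau_1,s_1;\tau_2,s_2)=\int_0^\infty e^{\lambda(\tau_2+\tau_1)}\mathrm{Ai}(\hat s_2+\lambda)\mathrm{Ai}(\hat s_1-\lambda)\,d\lambda,\qquad K_2(\tau_1,s_1;\tau_2,s_2)=\int_0^\infty e^{\lambda(\tau_2-\tau_1)}\mathrm{Ai}(\hat s_2+\lambda)\mathrm{Ai}(\hat s_1+\lambda)\,d\lambda,$$ for either of the exponents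 $\sigma\in\{1,-1\}$. A conjugate of a kernel $k(p,q)$ is a kernel $\rho(p)k(p,q)/\rho(q)$ with $\rho$ real-valued, measurable and nowhere zero; a trace-class conjugate is one that is the kernel of a trace-class integral operator on $\mathcal H$. For each of these kernels, the Fredholm determinant $\det(\mathbf 1-\chi_sK_\infty\chi_s)_{\mathcal H}$ is well defined: there exists a conjugate of $\chi_sK_\infty\chi_s$ which is trace class on $\mathcal H$, and there is exactly one number $d\in\mathbb C$ such that $\det(\mathbf 1-T)_{\mathcal H}=d$ for every operator $T$ given by a trace-class conjugate of $\chi_sK_\infty\chi_s$. -/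

import Mathlib

open MeasureTheory Filter Topology

noncomputable section

namespace AiryTransition

/-- The integral of `f` along the broken line that comes from `a + e^{-iφ}∞` straight to the
apex `a` and goes on straight to `a + e^{iφ}∞`. -/
def wedgeIntegral (a φ : ℝ) (f : ℂ → ℂ) : ℂ :=
  ∫ r in Set.Ioi (0 : ℝ),
    (f (a + r * Complex.exp (φ * Complex.I)) * Complex.exp (φ * Complex.I)
      - f (a + r * Complex.exp (-(φ * Complex.I))) * Complex.exp (-(φ * Complex.I)))

/-- The Airy function `Ai x = (2πi)⁻¹ ∫ exp (w³/3 - x w) dw`, integrated along a path from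
`e^{-iπ/3}∞` to `e^{iπ/3}∞`. -/
def airyAi (x : ℂ) : ℂ :=
  (2 * Real.pi * Complex.I)⁻¹ *
    wedgeIntegral 0 (Real.pi / 3) (fun w => Complex.exp (w ^ 3 / 3 - x * w))

/-- `s̃ = s - min {0, τ}²`. -/
def sTilde (τ s : ℝ) : ℝ := s - (min 0 τ) ^ 2

/-- `ŝ = s + max {0, τ}²`. -/
def sHat (τ s : ℝ) : ℝ := s + (max 0 τ) ^ 2

/-- The heat-kernel term
`-(4π(τ₂-τ₁))^{-1/2} exp (-(s̃₂-s̃₁)²/(4(τ₂-τ₁))) 1(τ₂ > τ₁)`. -/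
def heatTerm (τ₁ s₁ τ₂ s₂ : ℝ) : ℝ :=
  if τ₁ < τ₂ then
    -(1 / √(4 * Real.pi * (τ₂ - τ₁)) *
      Real.exp (-(sTilde τ₂ s₂ - sTilde τ₁ s₁) ^ 2 / (4 * (τ₂ - τ₁))))
  else 0

/-- The transition kernel in contour-integral form. The path `γ₊` has apex `a` and directions
`e^{±iφ₊}` and is run through from `e^{iφ₊}∞` to `e^{-iφ₊}∞` (whence the minus sign in front
of the double integral); `γ₋` has apex `b` and is run through from `e^{-iφ₋}∞` to
`e^{iφ₋}∞`. -/
def contourKernel (a b φp φm : ℝ) (τ₁ s₁ τ₂ s₂ : ℝ) : ℂ :=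
  heatTerm τ₁ s₁ τ₂ s₂ +
    ((2 * Real.pi * Complex.I) ^ 2)⁻¹ *
      -wedgeIntegral a φp (fun w => wedgeIntegral b φm (fun z =>
        Complex.exp (w ^ 3 / 3 + τ₂ * w ^ 2 - sTilde τ₂ s₂ * w) /
          Complex.exp (z ^ 3 / 3 + τ₁ * z ^ 2 - sTilde τ₁ s₁ * z) *
          (2 * w / ((z - w) * (z + w)))))

/-- The heat-kernel part of the kernel in Airy form, with the prefactor
`(exp (2τ₂³/3 + τ₂ s̃₂) / exp (2τ₁³/3 + τ₁ s̃₁)) ^ σ`, where `σ = ± 1`. -/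
def airyK0 (σ : ℝ) (τ₁ s₁ τ₂ s₂ : ℝ) : ℝ :=
  Real.exp (σ * ((2 / 3 * τ₂ ^ 3 + τ₂ * sTilde τ₂ s₂)
    - (2 / 3 * τ₁ ^ 3 + τ₁ * sTilde τ₁ s₁))) * heatTerm τ₁ s₁ τ₂ s₂

/-- `∫₀^∞ e^{λ(τ₂+τ₁)} Ai(ŝ₂+λ) Ai(ŝ₁-λ) dλ`. -/
def airyK1 (τ₁ s₁ τ₂ s₂ : ℝ) : ℂ :=
  ∫ l in Set.Ioi (0 : ℝ), Real.exp (l * (τ₂ + τ₁)) *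
    airyAi ((sHat τ₂ s₂ + l : ℝ)) * airyAi ((sHat τ₁ s₁ - l : ℝ))

/-- `∫₀^∞ e^{λ(τ₂-τ₁)} Ai(ŝ₂+λ) Ai(ŝ₁+λ) dλ`. -/
def airyK2 (τ₁ s₁ τ₂ s₂ : ℝ) : ℂ :=
  ∫ l in Set.Ioi (0 : ℝ), Real.exp (l * (τ₂ - τ₁)) *
    airyAi ((sHat τ₂ s₂ + l : ℝ)) * airyAi ((sHat τ₁ s₁ + l : ℝ))

/-- The transition kernel in Airy form, `K₀ + K₁ + K₂`. -/
def airyKernel (σ : ℝ) (τ₁ s₁ τ₂ s₂ : ℝ) : ℂ :=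
  airyK0 σ τ₁ s₁ τ₂ s₂ + airyK1 τ₁ s₁ τ₂ s₂ + airyK2 τ₁ s₁ τ₂ s₂

/-- Counting measure times Lebesgue measure on `{τ₁, …, τₘ} × ℝ`; the point `(τₖ, x)` is
written `(k, x)`. -/
def spaceMeasure (m : ℕ) : Measure (Fin m × ℝ) :=
  (Measure.count : Measure (Fin m)).prod volume

/-- The Hilbert space `L²({τ₁, …, τₘ} × ℝ)`. -/
abbrev HSpace (m : ℕ) : Type := Lp ℂ 2 (spaceMeasure m)

/-- The kernel `χₛ K χₛ` on `{τ₁, …, τₘ} × ℝ`, where `χₛ(τₖ, x) = 1(x > sₖ)`. -/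
def cutKernel {m : ℕ} (τ s : Fin m → ℝ) (K : ℝ → ℝ → ℝ → ℝ → ℂ) (p q : Fin m × ℝ) : ℂ :=
  if s p.1 < p.2 ∧ s q.1 < q.2 then K (τ p.1) p.2 (τ q.1) q.2 else 0

/-- `k'` is a conjugate of the kernel `k`: `k'(p, q) = ρ(p) k(p, q) / ρ(q)` for some measurable
function `ρ` without zeros. -/
def IsConjugateKernel {X : Type} [MeasurableSpace X] (k' k : X → X → ℂ) : Prop :=
  ∃ ρ : X → ℝ, Measurable ρ ∧ (∀ p, ρ p ≠ 0) ∧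
    ∀ p q, k' p q = (ρ p : ℂ) * k p q / (ρ q : ℂ)

/-- `T` is the integral operator on `L²(X, μ)` with kernel `k`. -/
def HasKernel {X : Type} [MeasurableSpace X] {μ : Measure X}
    (T : Lp ℂ 2 μ →L[ℂ] Lp ℂ 2 μ) (k : X → X → ℂ) : Prop :=
  ∀ f : Lp ℂ 2 μ, ∀ᵐ p ∂μ,
    Integrable (fun q => k p q * f q) μ ∧ T f p = ∫ q, k p q * f q ∂μ

/-- Trace-class (nuclear) operators on a Hilbert space: `T = ∑ₙ ⟨uₙ, ·⟩ vₙ` with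
`∑ₙ ‖uₙ‖ ‖vₙ‖ < ∞`. -/
def IsTraceClass {H : Type} [NormedAddCommGroup H] [InnerProductSpace ℂ H]
    (T : H →L[ℂ] H) : Prop :=
  ∃ u v : ℕ → H, Summable (fun n => ‖u n‖ * ‖v n‖) ∧
    ∀ f : H, HasSum (fun n => inner ℂ (u n) f • v n) (T f)

/-- `d` is the Fredholm determinant `det (1 - T)`: in every orthonormal basis `(eᵢ)` of `H`, the
finite minors `det (δᵢⱼ - ⟨eᵢ, T eⱼ⟩)`, `i, j ∈ F`, converge to `d` as the finite set `F` of
indices increases. -/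
def HasFredholmDet {H : Type} [NormedAddCommGroup H] [InnerProductSpace ℂ H]
    (T : H →L[ℂ] H) (d : ℂ) : Prop :=
  ∀ (ι : Type) [DecidableEq ι] (e : HilbertBasis ι ℂ H),
    Tendsto (fun F : Finset ι =>
      Matrix.det (1 - Matrix.of (fun i j : F => inner ℂ (e i) (T (e j))))) atTop (𝓝 d)

/-- `T` is a trace-class operator whose kernel is a conjugate of `k`. -/
def IsTraceClassConjugate {X : Type} [MeasurableSpace X] {μ : Measure X}
    (T : Lp ℂ 2 μ →L[ℂ] Lp ℂ 2 μ) (k : X → X → ℂ) : Prop :=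
  (∃ k' : X → X → ℂ, IsConjugateKernel k' k ∧ HasKernel T k') ∧ IsTraceClass T

/-- The Fredholm determinant of `1 - k` on `L²(X, μ)` is well defined through conjugation: `k` has
a trace-class conjugate, and there is exactly one number which is the Fredholm determinant of
`1 - T` for all trace-class conjugates `T` of `k`. -/
def FredholmDetWellDefined {X : Type} [MeasurableSpace X] (μ : Measure X)
    (k : X → X → ℂ) : Prop :=
  (∃ T : Lp ℂ 2 μ →L[ℂ] Lp ℂ 2 μ, IsTraceClassConjugate T k) ∧
    ∃! d : ℂ, ∀ T : Lp ℂ 2 μ →L[ℂ] Lp ℂ 2 μ, IsTraceClassConjugate T k → HasFredholmDet T d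

end AiryTransition

end

/-! For a nuclear operator `T = ∑ ⟨uₙ, ·⟩ vₙ` the determinant of `1 - T` is the limit of the `N × N`
minors of `1 - (⟨uₙ, vₘ⟩)`. Hadamard's inequality for mixed Gram determinants bounds the `N`-th
increment of these minors by `‖u_N‖ ‖v_N‖ ∏ (1 + ‖uᵢ‖ ‖vᵢ‖)`. Hence the limit `seqDet` exists and
obeys dominated convergence in `u, v`. The identity `det (1 - AB) = det (1 - BA)` and Parseval's
identity show that the minors in every Hilbert basis have the same limit (`hasFredholmDet_seqDet`).

Uniqueness: two conjugates of one kernel are conjugate to each other by some `ρ`, but `ρ` and `1/ρ`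
may be unbounded, so no bounded similarity is available. On the set where `|ρ|` and `|1/ρ|` are at
most `n` the conjugation is bounded and the determinants of the truncated operators agree; letting
`n → ∞` inside `seqDet` gives the claim (`seqDet_eq_of_conjugate`).

Existence: conjugate by `exp (D_k x)`, with a rate `D_k` for each time, and write each part of the
kernel as a product of two Hilbert–Schmidt kernels (`isNuclearKernel_cut`). The heat part has no
decay along the diagonal `x ≈ y`; rates that increase strictly with time supply it
(`isNuclearKernel_heat`). The Airy integrals tolerate any rates, since `Ai x = O(e^{-δx})` on the
whole line for every `δ > 0` (`exists_norm_airyAi_le`). The contour integral tolerates `D = -c` with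
`b < c_k < a`, because `Re z ≤ b` and `Re w ≥ a` on the two paths, so a decreasing choice of `c_k`
serves both parts. -/

open MeasureTheory Filter Topology

namespace AiryTransition

/-! ### Fredholm determinants of nuclear operators via Hadamard's inequality -/

section Determinants

variable {H : Type*} [NormedAddCommGroup H] [InnerProductSpace ℂ H]

/-- Hadamard's inequality for coordinates in an orthonormal basis. -/
theorem norm_orthonormalBasis_det_le [FiniteDimensional ℂ H] {n : ℕ}
    (b : OrthonormalBasis (Fin n) ℂ H) (v : Fin n → H) :
    ‖b.toBasis.det v‖ ≤ ∏ i, ‖v i‖ := by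
  have hd : Module.finrank ℂ H = Fintype.card (Fin n) := Module.finrank_eq_card_basis b.toBasis
  -- In the Gram–Schmidt basis of `v` the coordinate matrix is triangular, with diagonal entries
  -- `⟨gᵢ, vᵢ⟩`; the change between two orthonormal bases has determinant of modulus one.
  set g := InnerProductSpace.gramSchmidtOrthonormalBasis hd v
  have h1 : b.toBasis.det v = b.toBasis.det g.toBasis * g.toBasis.det v := by
    have := congrArg (fun f => f v) (b.toBasis.det.eq_smul_basis_det g.toBasis)
    simpa using this
  have h2 : ‖b.toBasis.det g.toBasis‖ = 1 := by
    exact b.det_to_matrix_orthonormalBasis g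
  rw [h1, norm_mul, h2, one_mul,
    InnerProductSpace.gramSchmidtOrthonormalBasis_det hd v, norm_prod]
  refine Finset.prod_le_prod (fun _ _ => norm_nonneg _) fun i _ => ?_
  refine (norm_inner_le_norm _ _).trans ?_
  simp

/-- Projecting the `uᵢ` onto the span of the `vⱼ` does not change the entries. If the `vⱼ` are
independent, the matrix is then a product of two square coordinate matrices, and Hadamard's
inequality applies to each; if they are dependent, the determinant vanishes. -/
theorem norm_det_inner_le_fin {n : ℕ} (u v : Fin n → H) :
    ‖Matrix.det (Matrix.of fun i j => inner ℂ (u i) (v j))‖ ≤ ∏ i, ‖u i‖ * ‖v i‖ := by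
  by_cases hv : LinearIndependent ℂ v
  · let W := Submodule.span ℂ (Set.range v)
    have : FiniteDimensional ℂ W := FiniteDimensional.span_of_finite ℂ (Set.finite_range v)
    have hW : Module.finrank ℂ W = n := by
      simpa using finrank_span_eq_card hv
    let b : OrthonormalBasis (Fin n) ℂ W := (stdOrthonormalBasis ℂ W).reindex (finCongr hW)
    let v' : Fin n → W := fun i => ⟨v i, Submodule.subset_span ⟨i, rfl⟩⟩
    let u' : Fin n → W := fun i => W.orthogonalProjectionOnto (u i)
    have hM : (Matrix.of fun i j => inner ℂ (u i) (v j)) =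
        (b.toBasis.toMatrix u').conjTranspose * b.toBasis.toMatrix v' := by
      ext i j
      have h1 : inner ℂ (u i) (v j) = inner ℂ (u' i) (v' j) := by
        simp only [u']
        rw [Submodule.inner_orthogonalProjectionOnto_eq_of_mem_right]
      rw [Matrix.of_apply, h1, ← b.sum_inner_mul_inner, Matrix.mul_apply]
      refine Finset.sum_congr rfl fun k _ => ?_
      simp [Module.Basis.toMatrix_apply, b.repr_apply_apply]
    rw [hM, Matrix.det_mul, Matrix.det_conjTranspose, norm_mul, norm_star,
      Finset.prod_mul_distrib]
    gcongr
    · refine (norm_orthonormalBasis_det_le b u').trans ?_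
      exact Finset.prod_le_prod (fun _ _ => norm_nonneg _) fun i _ =>
        W.norm_orthogonalProjectionOnto_apply_le (u i)
    · exact norm_orthonormalBasis_det_le b v'
  · rw [Fintype.not_linearIndependent_iff] at hv
    obtain ⟨c, hc, i, hi⟩ := hv
    have : Matrix.det (Matrix.of fun i j => inner ℂ (u i) (v j)) = 0 := by
      rw [← Matrix.exists_mulVec_eq_zero_iff]
      refine ⟨c, fun h => hi (by simp [h]), ?_⟩
      ext k
      have : inner ℂ (u k) (∑ i, c i • v i) = 0 := by rw [hc, inner_zero_right]
      simpa [Matrix.mulVec, dotProduct, inner_sum, inner_smul_right, mul_comm] using this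
    rw [this, norm_zero]
    positivity

/-- Hadamard's inequality for mixed Gram determinants. -/
theorem norm_det_inner_le {ι : Type*} [Fintype ι] [DecidableEq ι] (u v : ι → H) :
    ‖Matrix.det (Matrix.of fun i j => inner ℂ (u i) (v j))‖ ≤ ∏ i, ‖u i‖ * ‖v i‖ := by
  let e := (Fintype.equivFin ι).symm
  have := norm_det_inner_le_fin (u ∘ e) (v ∘ e)
  rw [← Matrix.det_submatrix_equiv_self e, ← Equiv.prod_comp e]
  exact this

/-- A determinant in which the rows outside `s` are unit vectors. -/
theorem det_piecewise_single {ι : Type*} [Fintype ι] [DecidableEq ι] (s : Finset ι)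
    (A : ι → ι → ℂ) :
    Matrix.det (Matrix.of (s.piecewise A fun i => Pi.single i 1)) =
      Matrix.det (Matrix.of fun i j : s => A i j) := by
  set M : Matrix ι ι ℂ := Matrix.of (s.piecewise A fun i => Pi.single i 1)
  have hin : ∀ i ∈ s, ∀ j, M i j = A i j := fun i hi j => by
    simp [M, hi]
  have hout : ∀ i ∉ s, ∀ j, M i j = (1 : Matrix ι ι ℂ) i j := fun i hi j => by
    simp [M, hi, Matrix.one_apply, Pi.single_apply, eq_comm]
  rw [Matrix.twoBlockTriangular_det M (fun i => i ∈ s)]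
  · have h2 : Matrix.toSquareBlockProp M (fun i => ¬ i ∈ s) = 1 := by
      ext i j
      refine (hout i i.2 j).trans ?_
      simp [Matrix.one_apply, Subtype.ext_iff]
    have h1 : Matrix.toSquareBlockProp M (fun i => i ∈ s) = Matrix.of fun i j : s => A i j := by
      ext i j
      exact hin i i.2 j
    rw [h2, Matrix.det_one, mul_one, h1]
    convert rfl
  · intro i hi j hj
    rw [hout i hi]
    exact Matrix.one_apply_ne (by rintro rfl; exact hi hj)

theorem norm_det_piecewise_inner_le {ι : Type*} [Fintype ι] [DecidableEq ι] (s : Finset ι)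
    (u v : ι → H) :
    ‖Matrix.det (Matrix.of (s.piecewise (fun i j => inner ℂ (u i) (v j))
      fun i => Pi.single i 1))‖ ≤ ∏ i ∈ s, ‖u i‖ * ‖v i‖ := by
  rw [det_piecewise_single s, ← Finset.prod_coe_sort]
  exact norm_det_inner_le (fun i : s => u i) (fun i : s => v i)

/-- The leading `N × N` minor of `1 - g`. -/
noncomputable def leadingMinor (g : ℕ → ℕ → ℂ) (N : ℕ) : ℂ :=
  Matrix.det (1 - Matrix.of fun i j : Fin N => g i j)

/-- The determinant is additive in its last row `e_N - g N`; the summand with last row `e_N` is the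
minor of size `N`. -/
theorem leadingMinor_succ_sub (g : ℕ → ℕ → ℂ) (N : ℕ) :
    leadingMinor g (N + 1) - leadingMinor g N =
      Matrix.det (Matrix.updateRow (1 - Matrix.of fun i j : Fin (N + 1) => g i j) (Fin.last N)
        (-(fun j : Fin (N + 1) => g N j))) := by
  set M : Matrix (Fin (N + 1)) (Fin (N + 1)) ℂ := 1 - Matrix.of fun i j : Fin (N + 1) => g i j
  have hrow : M = M.updateRow (Fin.last N)
      ((1 : Matrix (Fin (N + 1)) (Fin (N + 1)) ℂ) (Fin.last N) + -(fun j : Fin (N + 1) => g N j)) := by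
    ext i j
    rcases eq_or_ne i (Fin.last N) with rfl | hi
    · simp [M, sub_eq_add_neg]
    · simp [Matrix.updateRow_ne hi]
  have h1 : Matrix.det (M.updateRow (Fin.last N)
      ((1 : Matrix (Fin (N + 1)) (Fin (N + 1)) ℂ) (Fin.last N))) = leadingMinor g N := by
    rw [Matrix.det_succ_row _ (Fin.last N), Finset.sum_eq_single (Fin.last N)]
    · have : ((M.updateRow (Fin.last N)
          ((1 : Matrix (Fin (N + 1)) (Fin (N + 1)) ℂ) (Fin.last N))).submatrix
          (Fin.last N).succAbove (Fin.last N).succAbove) =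
          1 - Matrix.of fun i j : Fin N => g i j := by
        ext i j
        simp [M, Matrix.one_apply]
      rw [this]
      simp [leadingMinor, ← two_mul]
    · intro j _ hj
      simp [Matrix.one_apply_ne hj.symm]
    · simp
  have h2 : leadingMinor g (N + 1) = M.det := rfl
  rw [h2, ← h1]
  conv_lhs => enter [1]; rw [hrow, Matrix.det_updateRow_add]
  ring

/-- Expanding every row other than the last as unit vector minus Gram row gives a sum of principal
Gram minors that all contain the index `N`. Hadamard's inequality bounds each by a product, and the
sum of these products factors. -/
theorem norm_leadingMinor_succ_sub_le (u v : ℕ → H) (N : ℕ) :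
    ‖leadingMinor (fun n m => inner ℂ (u n) (v m)) (N + 1) -
      leadingMinor (fun n m => inner ℂ (u n) (v m)) N‖ ≤
      ‖u N‖ * ‖v N‖ * ∏ i ∈ Finset.range N, (1 + ‖u i‖ * ‖v i‖) := by
  rw [leadingMinor_succ_sub]
  -- The zero last row of `E` kills every subset that misses the last index, and the factor 0 in
  -- `hb` records this.
  set E : Fin (N + 1) → Fin (N + 1) → ℂ :=
    fun i => if i = Fin.last N then 0 else Pi.single i 1
  set G : Fin (N + 1) → Fin (N + 1) → ℂ := fun i j => inner ℂ (-u i) (v j)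
  have hM : (Matrix.updateRow
      (1 - Matrix.of fun i j : Fin (N + 1) => (fun n m => inner ℂ (u n) (v m)) (i : ℕ) (j : ℕ))
      (Fin.last N) (-(fun j : Fin (N + 1) => inner ℂ (u N) (v j)))) = Matrix.of (G + E) := by
    ext i j
    rcases eq_or_ne i (Fin.last N) with rfl | hi
    · simp [G, E]
    · simp [G, E, hi, sub_eq_neg_add, Matrix.one_apply, Pi.single_apply, eq_comm]
  have hb : ∀ s : Finset (Fin (N + 1)), ‖Matrix.det (Matrix.of (s.piecewise G E))‖ ≤
      (∏ i ∈ s, ‖u i‖ * ‖v i‖) * ∏ i ∈ sᶜ, if i = Fin.last N then 0 else 1 := by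
    intro s
    by_cases hs : Fin.last N ∈ s
    · have h1 : s.piecewise G E = s.piecewise G fun i => Pi.single i 1 := by
        ext i j
        by_cases hi : i ∈ s
        · simp [hi]
        · have : i ≠ Fin.last N := by rintro rfl; exact hi hs
          simp [hi, E, this]
      have h2 : (∏ i ∈ sᶜ, if i = Fin.last N then (0 : ℝ) else 1) = 1 := by
        refine Finset.prod_eq_one fun i hi => if_neg ?_
        rintro rfl
        exact Finset.mem_compl.1 hi hs
      rw [h1, h2, mul_one]
      refine (norm_det_piecewise_inner_le s (fun i : Fin (N + 1) => -u i)
        (fun i : Fin (N + 1) => v i)).trans_eq ?_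
      simp
    · rw [Matrix.det_eq_zero_of_row_eq_zero (Fin.last N), norm_zero]
      · refine mul_nonneg (by positivity) (Finset.prod_nonneg fun i _ => ?_)
        split_ifs <;> norm_num
      · intro j
        simp [hs, E]
  have hsum : Matrix.det (Matrix.of (G + E)) =
      ∑ s : Finset (Fin (N + 1)), Matrix.det (Matrix.of (s.piecewise G E)) :=
    (Matrix.detRowAlternating (n := Fin (N + 1)) (R := ℂ)).toMultilinearMap.map_add_univ G E
  rw [hM, hsum]
  refine (norm_sum_le _ _).trans ((Finset.sum_le_sum fun s _ => hb s).trans_eq ?_)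
  rw [← Finset.powerset_univ]
  simp only [Finset.compl_eq_univ_sdiff]
  rw [← Finset.prod_add, Fin.prod_univ_castSucc, mul_comm, Finset.prod_range]
  simp [add_comm]

/-- The limit of the leading minors of `1 - g`, as a sum of increments. -/
noncomputable def seqDet (g : ℕ → ℕ → ℂ) : ℂ :=
  1 + ∑' N, (leadingMinor g (N + 1) - leadingMinor g N)

theorem norm_leadingMinor_inc_le {u v : ℕ → H} {a : ℕ → ℝ} (ha : Summable a)
    (huv : ∀ n, ‖u n‖ * ‖v n‖ ≤ a n) (N : ℕ) :
    ‖leadingMinor (fun n m => inner ℂ (u n) (v m)) (N + 1) -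
      leadingMinor (fun n m => inner ℂ (u n) (v m)) N‖ ≤ a N * Real.exp (∑' n, a n) := by
  have h0 : ∀ n, 0 ≤ ‖u n‖ * ‖v n‖ := fun n => by positivity
  refine (norm_leadingMinor_succ_sub_le u v N).trans ?_
  gcongr
  · exact (h0 N).trans (huv N)
  · exact huv N
  · calc ∏ i ∈ Finset.range N, (1 + ‖u i‖ * ‖v i‖)
        ≤ ∏ i ∈ Finset.range N, Real.exp (a i) := by
          refine Finset.prod_le_prod (fun i _ => by positivity) fun i _ => ?_
          have := Real.add_one_le_exp (a i)
          linarith [huv i]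
      _ = Real.exp (∑ i ∈ Finset.range N, a i) := (Real.exp_sum _ _).symm
      _ ≤ _ := Real.exp_le_exp.2 (ha.sum_le_tsum _ fun i _ => (h0 i).trans (huv i))

theorem tendsto_leadingMinor {u v : ℕ → H} (huv : Summable fun n => ‖u n‖ * ‖v n‖) :
    Tendsto (leadingMinor fun n m => inner ℂ (u n) (v m)) atTop
      (𝓝 (seqDet fun n m => inner ℂ (u n) (v m))) := by
  have hs : Summable fun N => leadingMinor (fun n m => inner ℂ (u n) (v m)) (N + 1) -
      leadingMinor (fun n m => inner ℂ (u n) (v m)) N :=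
    Summable.of_norm_bounded (huv.mul_right _) (norm_leadingMinor_inc_le huv fun _ => le_rfl)
  have := hs.hasSum.tendsto_sum_nat.const_add 1
  refine this.congr fun N => ?_
  rw [Finset.sum_range_sub]
  simp [leadingMinor]

/-- Dominated convergence for `seqDet`. -/
theorem tendsto_seqDet {α : Type*} {l : Filter α} {u v : α → ℕ → H} {g : ℕ → ℕ → ℂ} {a : ℕ → ℝ}
    (ha : Summable a) (huv : ∀ x n, ‖u x n‖ * ‖v x n‖ ≤ a n)
    (hg : ∀ n m, Tendsto (fun x => inner ℂ (u x n) (v x m)) l (𝓝 (g n m))) :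
    Tendsto (fun x => seqDet fun n m => inner ℂ (u x n) (v x m)) l (𝓝 (seqDet g)) := by
  have hm : ∀ N, Tendsto (fun x => leadingMinor (fun n m => inner ℂ (u x n) (v x m)) N) l
      (𝓝 (leadingMinor g N)) := by
    intro N
    have h1 : Tendsto (fun x => (1 - Matrix.of fun i j : Fin N => inner ℂ (u x i) (v x j) :
        Matrix (Fin N) (Fin N) ℂ)) l (𝓝 (1 - Matrix.of fun i j : Fin N => g i j)) := by
      refine Tendsto.sub tendsto_const_nhds ?_
      exact tendsto_pi_nhds.2 fun i => tendsto_pi_nhds.2 fun j => hg i j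
    exact ((continuous_id.matrix_det).tendsto _).comp h1
  refine Tendsto.const_add 1 (tendsto_tsum_of_dominated_convergence (ha.mul_right _)
    (fun N => (hm (N + 1)).sub (hm N)) (Eventually.of_forall fun x N =>
      norm_leadingMinor_inc_le ha (huv x) N))

/-- A trace-class operator has the Fredholm determinant given by any of its expansions. -/
theorem hasFredholmDet_seqDet {H : Type} [NormedAddCommGroup H] [InnerProductSpace ℂ H]
    {T : H →L[ℂ] H} {u v : ℕ → H} (huv : Summable fun n => ‖u n‖ * ‖v n‖)
    (hT : ∀ f, HasSum (fun n => inner ℂ (u n) f • v n) (T f)) :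
    HasFredholmDet T (seqDet fun n m => inner ℂ (u n) (v m)) := by
  intro ι _ e
  -- The orthogonal projection of `u n` onto the span of the `eᵢ`, `i ∈ F`: compressing `T` to this
  -- span amounts to replacing `u` by `P F`.
  let P : Finset ι → ℕ → H := fun F n => ∑ i ∈ F, inner ℂ (e i) (u n) • e i
  have hP : ∀ F n w, inner ℂ (P F n) w = ∑ i ∈ F, inner ℂ (u n) (e i) * inner ℂ (e i) w := by
    intro F n w
    simp [P, mul_comm]
  have hPn : ∀ F n, ‖P F n‖ ≤ ‖u n‖ := by
    intro F n
    have h1 : ‖P F n‖ ^ 2 = ∑ i ∈ F, ‖inner ℂ (e i) (u n)‖ ^ 2 := by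
      rw [← inner_self_eq_norm_sq (𝕜 := ℂ), hP]
      rw [map_sum]
      refine Finset.sum_congr rfl fun i hi => ?_
      have : inner ℂ (e i) (P F n) = inner ℂ (e i) (u n) :=
        e.orthonormal.inner_right_sum _ hi
      rw [this, ← inner_conj_symm (u n) (e i), ← Complex.normSq_eq_conj_mul_self,
        Complex.normSq_eq_norm_sq]
      exact Complex.ofReal_re _
    have h2 := e.orthonormal.sum_inner_products_le (u n) (s := F)
    rw [← h1] at h2
    exact le_of_sq_le_sq h2 (norm_nonneg _)
  have hmin : ∀ F : Finset ι,
      Matrix.det (1 - Matrix.of (fun i j : F => inner ℂ (e i) (T (e j)))) =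
        seqDet fun n m => inner ℂ (P F n) (v m) := by
    intro F
    have hs : Summable fun n => ‖P F n‖ * ‖v n‖ :=
      Summable.of_nonneg_of_le (fun n => by positivity)
        (fun n => mul_le_mul_of_nonneg_right (hPn F n) (norm_nonneg _)) huv
    refine tendsto_nhds_unique ?_ (tendsto_leadingMinor hs)
    have hl : ∀ N, leadingMinor (fun n m => inner ℂ (P F n) (v m)) N =
        Matrix.det (1 - Matrix.of (fun i j : F =>
          ∑ n ∈ Finset.range N, inner ℂ (u n) (e j) * inner ℂ (e i) (v n))) := by
      intro N
      have h1 : (Matrix.of fun i j : Fin N => inner ℂ (P F i) (v j)) =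
          (Matrix.of fun (i : Fin N) (k : F) => inner ℂ (u i) (e k)) *
            (Matrix.of fun (k : F) (j : Fin N) => inner ℂ (e k) (v j)) := by
        ext i j
        rw [Matrix.of_apply, hP, Matrix.mul_apply, ← Finset.sum_coe_sort]
        rfl
      -- Passing from `det (1 - AB)` to `det (1 - BA)` turns an `N × N` minor into a minor indexed
      -- by `F`, whose entries converge as `N → ∞`.
      rw [leadingMinor, h1, Matrix.det_one_sub_mul_comm]
      congr 2
      ext i j
      rw [Matrix.mul_apply, Matrix.of_apply, Finset.sum_range]
      simp [mul_comm]
    refine Tendsto.congr (fun N => (hl N).symm) ?_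
    have hc : Tendsto (fun N => (1 - Matrix.of (fun i j : F =>
          ∑ n ∈ Finset.range N, inner ℂ (u n) (e j) * inner ℂ (e i) (v n)) : Matrix F F ℂ)) atTop
        (𝓝 (1 - Matrix.of (fun i j : F => inner ℂ (e i) (T (e j))))) := by
      refine Tendsto.sub tendsto_const_nhds ?_
      refine tendsto_pi_nhds.2 fun i => tendsto_pi_nhds.2 fun j => ?_
      have := ((hT (e j)).mapL (innerSL ℂ (e i))).tendsto_sum_nat
      simpa [inner_smul_right] using this
    exact ((continuous_id.matrix_det).tendsto _).comp hc
  refine Tendsto.congr (fun F => (hmin F).symm) ?_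
  -- Bessel's inequality gives the bound uniform in `F`, Parseval's identity the convergence of the
  -- entries.
  refine tendsto_seqDet huv (fun F n => mul_le_mul_of_nonneg_right (hPn F n) (norm_nonneg _)) ?_
  intro n m
  exact Tendsto.congr (fun F => (hP F n (v m)).symm) (e.hasSum_inner_mul_inner (u n) (v m))

end Determinants
end AiryTransition

namespace AiryTransition

/-! ### Invariance of the determinant under unbounded conjugation -/

section Conjugation

variable {X : Type} [MeasurableSpace X] {μ : Measure X}

/-- Multiplication by a bounded measurable function on `L²`. -/
theorem exists_mulOp {φ : X → ℝ} (hφ : Measurable φ) {C : ℝ} (hC : ∀ x, |φ x| ≤ C) :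
    ∃ M : Lp ℂ 2 μ →L[ℂ] Lp ℂ 2 μ, ∀ f, M f =ᵐ[μ] fun x => (φ x : ℂ) * f x := by
  have hm : ∀ f : Lp ℂ 2 μ, MemLp (fun x => (φ x : ℂ) * f x) 2 μ := fun f =>
    MemLp.of_le_mul (c := C) (Lp.memLp f)
      ((Complex.measurable_ofReal.comp hφ).aestronglyMeasurable.mul (Lp.aestronglyMeasurable f))
      (Eventually.of_forall fun x => by
        rw [norm_mul, Complex.norm_real, Real.norm_eq_abs]
        exact mul_le_mul_of_nonneg_right (hC x) (norm_nonneg _))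
  let M₀ : Lp ℂ 2 μ →ₗ[ℂ] Lp ℂ 2 μ :=
    { toFun := fun f => (hm f).toLp _
      map_add' := fun f g => by
        ext1
        filter_upwards [(hm (f + g)).coeFn_toLp, (hm f).coeFn_toLp, (hm g).coeFn_toLp,
          Lp.coeFn_add f g, Lp.coeFn_add ((hm f).toLp _) ((hm g).toLp _)] with x h1 h2 h3 h4 h5
        rw [h1, h5, Pi.add_apply, h2, h3, h4, Pi.add_apply, mul_add]
      map_smul' := fun c f => by
        ext1
        filter_upwards [(hm (c • f)).coeFn_toLp, (hm f).coeFn_toLp,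
          Lp.coeFn_smul c f, Lp.coeFn_smul c ((hm f).toLp _)] with x h1 h2 h3 h4
        rw [h1, RingHom.id_apply, h4, Pi.smul_apply, h2, h3, Pi.smul_apply, smul_eq_mul,
          smul_eq_mul]
        ring }
  refine ⟨M₀.mkContinuous C fun f => ?_, fun f => (hm f).coeFn_toLp⟩
  refine Lp.norm_le_mul_norm_of_ae_le_mul ?_
  filter_upwards [(hm f).coeFn_toLp] with x hx
  refine (congrArg norm hx).trans_le ?_
  rw [norm_mul, Complex.norm_real, Real.norm_eq_abs]
  exact mul_le_mul_of_nonneg_right (hC x) (norm_nonneg _)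

theorem inner_mulOp_left {φ : X → ℝ} {M : Lp ℂ 2 μ →L[ℂ] Lp ℂ 2 μ}
    (hM : ∀ f, M f =ᵐ[μ] fun x => (φ x : ℂ) * f x) (f g : Lp ℂ 2 μ) :
    inner ℂ (M f) g = ∫ x, (φ x : ℂ) * inner ℂ (f x) (g x) ∂μ := by
  rw [L2.inner_def]
  refine integral_congr_ae ?_
  filter_upwards [hM f] with x hx
  rw [hx]
  simp
  ring

theorem inner_mulOp_comm {φ : X → ℝ} {M : Lp ℂ 2 μ →L[ℂ] Lp ℂ 2 μ}
    (hM : ∀ f, M f =ᵐ[μ] fun x => (φ x : ℂ) * f x) (f g : Lp ℂ 2 μ) :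
    inner ℂ (M f) g = inner ℂ f (M g) := by
  rw [inner_mulOp_left hM, L2.inner_def]
  refine integral_congr_ae ?_
  filter_upwards [hM g] with x hx
  rw [hx]
  simp
  ring

theorem norm_mulOp_le {φ : X → ℝ} {M : Lp ℂ 2 μ →L[ℂ] Lp ℂ 2 μ}
    (hM : ∀ f, M f =ᵐ[μ] fun x => (φ x : ℂ) * f x) {C : ℝ} (hC : ∀ x, |φ x| ≤ C)
    (f : Lp ℂ 2 μ) : ‖M f‖ ≤ C * ‖f‖ := by
  refine Lp.norm_le_mul_norm_of_ae_le_mul ?_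
  filter_upwards [hM f] with x hx
  rw [hx, norm_mul, Complex.norm_real, Real.norm_eq_abs]
  exact mul_le_mul_of_nonneg_right (hC x) (norm_nonneg _)

/-- Sandwiching a nuclear operator between symmetric operators. -/
theorem hasSum_sandwich {H : Type*} [NormedAddCommGroup H] [InnerProductSpace ℂ H]
    {T A B : H →L[ℂ] H} {u v : ℕ → H} (hT : ∀ f, HasSum (fun n => inner ℂ (u n) f • v n) (T f))
    (hB : ∀ f g, inner ℂ (B f) g = inner ℂ f (B g)) (f : H) :
    HasSum (fun n => inner ℂ (B (u n)) f • A (v n)) ((A ∘L T ∘L B) f) := by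
  have := (hT (B f)).mapL A
  simpa [hB] using this

theorem summable_sandwich {H : Type*} [NormedAddCommGroup H] [InnerProductSpace ℂ H]
    {A B : H →L[ℂ] H} {u v : ℕ → H} (huv : Summable fun n => ‖u n‖ * ‖v n‖) :
    Summable fun n => ‖B (u n)‖ * ‖A (v n)‖ := by
  refine Summable.of_nonneg_of_le (fun n => by positivity) (fun n => ?_)
    (huv.mul_left (‖B‖ * ‖A‖))
  calc ‖B (u n)‖ * ‖A (v n)‖ ≤ (‖B‖ * ‖u n‖) * (‖A‖ * ‖v n‖) := by
        gcongr <;> exact ContinuousLinearMap.le_opNorm _ _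
    _ = _ := by ring

/-- The definition quantifies over all Hilbert bases, so uniqueness needs one to exist; completeness
provides it. -/
theorem HasFredholmDet.unique {H : Type} [NormedAddCommGroup H] [InnerProductSpace ℂ H]
    [CompleteSpace H] {T : H →L[ℂ] H} {d d' : ℂ} (h : HasFredholmDet T d)
    (h' : HasFredholmDet T d') : d = d' := by
  classical
  obtain ⟨w, b, -⟩ := exists_hilbertBasis ℂ H
  exact tendsto_nhds_unique (h w b) (h' w b)

/-- Two nuclear operators whose kernels differ by a conjugation have the same determinant. -/
theorem seqDet_eq_of_conjugate {T₁ T₂ : Lp ℂ 2 μ →L[ℂ] Lp ℂ 2 μ} {k₁ k₂ : X → X → ℂ}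
    {ρ : X → ℝ} (hρ : Measurable ρ) (hρ0 : ∀ p, ρ p ≠ 0)
    (hk : ∀ p q, k₂ p q = (ρ p : ℂ) * k₁ p q / (ρ q : ℂ))
    (h₁ : HasKernel T₁ k₁) (h₂ : HasKernel T₂ k₂) {u₁ v₁ u₂ v₂ : ℕ → Lp ℂ 2 μ}
    (hs₁ : Summable fun n => ‖u₁ n‖ * ‖v₁ n‖) (hs₂ : Summable fun n => ‖u₂ n‖ * ‖v₂ n‖)
    (hT₁ : ∀ f, HasSum (fun n => inner ℂ (u₁ n) f • v₁ n) (T₁ f))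
    (hT₂ : ∀ f, HasSum (fun n => inner ℂ (u₂ n) f • v₂ n) (T₂ f)) :
    (seqDet fun n m => inner ℂ (u₁ n) (v₁ m)) = seqDet fun n m => inner ℂ (u₂ n) (v₂ m) := by
  -- These sets exhaust `X`, and on each of them multiplication by `ρ` and by `1/ρ` is bounded.
  -- Below, `M`, `R`, `Q` multiply by `χ`, `χρ`, `χ/ρ`.
  let S : ℕ → Set X := fun n => {p | |ρ p| ≤ n ∧ |(ρ p)⁻¹| ≤ n}
  have hS : ∀ n, MeasurableSet (S n) := fun n =>
    (measurableSet_le (measurable_norm.comp hρ) measurable_const).inter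
      (measurableSet_le (measurable_norm.comp hρ.inv) measurable_const)
  let χ : ℕ → X → ℝ := fun n => (S n).indicator fun _ => 1
  have hχm : ∀ n, Measurable (χ n) := fun n => measurable_const.indicator (hS n)
  have hχ : ∀ n x, |χ n x| ≤ 1 := fun n x => by
    by_cases hx : x ∈ S n <;> simp [χ, hx]
  have hχρ : ∀ n x, |χ n x * ρ x| ≤ n := fun n x => by
    by_cases hx : x ∈ S n
    · simpa [χ, hx] using hx.1
    · simp [χ, hx]
  have hχρi : ∀ n x, |χ n x * (ρ x)⁻¹| ≤ n := fun n x => by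
    by_cases hx : x ∈ S n
    · simpa [χ, hx] using hx.2
    · simp [χ, hx]
  choose M hM using fun n => exists_mulOp (μ := μ) (hχm n) (hχ n)
  choose R hR using fun n => exists_mulOp (μ := μ) (φ := fun x => χ n x * ρ x)
    ((hχm n).mul hρ) (hχρ n)
  choose Q hQ using fun n => exists_mulOp (μ := μ) (φ := fun x => χ n x * (ρ x)⁻¹)
    ((hχm n).mul hρ.inv) (hχρi n)
  have hχχ : ∀ n x, χ n x * χ n x = χ n x := fun n x => by
    by_cases hx : x ∈ S n <;> simp [χ, hx]
  have hop : ∀ n, M n ∘L T₂ ∘L M n = R n ∘L T₁ ∘L Q n := by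
    intro n
    ext1 f
    ext1
    filter_upwards [hM n (T₂ (M n f)), hR n (T₁ (Q n f)), h₁ (Q n f), h₂ (M n f)]
      with p e1 e2 e3 e4
    refine e1.trans (Eq.trans ?_ e2.symm)
    rw [e3.2, e4.2]
    push_cast
    rw [mul_assoc, ← integral_const_mul (ρ p : ℂ)]
    congr 1
    refine integral_congr_ae ?_
    filter_upwards [hM n f, hQ n f] with q d1 d2
    rw [d1, d2, hk]
    push_cast
    field_simp
  -- Since `(χ/ρ)(χρ) = χ`, the weight disappears from the Gram entries of `R T₁ Q`; this is where
  -- conjugation leaves the determinant unchanged.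
  have hMQ : ∀ n f g, inner ℂ (Q n f) (R n g) = inner ℂ (M n f) g := by
    intro n f g
    rw [inner_mulOp_left (hQ n), inner_mulOp_left (hM n)]
    refine integral_congr_ae ?_
    filter_upwards [hR n g] with x hx
    rw [hx]
    have h0 : (ρ x : ℂ) ≠ 0 := Complex.ofReal_ne_zero.2 (hρ0 x)
    have h1 : (χ n x : ℂ) * χ n x = χ n x := by exact_mod_cast hχχ n x
    push_cast
    simp only [RCLike.inner_apply]
    calc _ = ((χ n x : ℂ) * χ n x) * (ρ x * (ρ x : ℂ)⁻¹) * (g x * (starRingEnd ℂ) (f x)) := by ring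
      _ = _ := by rw [h1, mul_inv_cancel₀ h0]; ring
  have hMM : ∀ n f g, inner ℂ (M n f) (M n g) = inner ℂ (M n f) g := by
    intro n f g
    rw [inner_mulOp_left (hM n), inner_mulOp_left (hM n)]
    refine integral_congr_ae ?_
    filter_upwards [hM n g] with x hx
    rw [hx]
    have h1 : (χ n x : ℂ) * χ n x = χ n x := by exact_mod_cast hχχ n x
    simp only [RCLike.inner_apply]
    calc _ = ((χ n x : ℂ) * χ n x) * (g x * (starRingEnd ℂ) (f x)) := by ring
      _ = _ := by rw [h1]
  have heq : ∀ n, (seqDet fun i j => inner ℂ (M n (u₁ i)) (v₁ j)) =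
      seqDet fun i j => inner ℂ (M n (u₂ i)) (v₂ j) := by
    intro n
    have e1 := hasFredholmDet_seqDet (summable_sandwich (A := R n) (B := Q n) hs₁)
      (hasSum_sandwich hT₁ (inner_mulOp_comm (hQ n)))
    have e2 := hasFredholmDet_seqDet (summable_sandwich (A := M n) (B := M n) hs₂)
      (hasSum_sandwich hT₂ (inner_mulOp_comm (hM n)))
    rw [← hop n] at e1
    simp only [hMQ] at e1
    simp only [hMM] at e2
    exact e1.unique e2
  have hlim : ∀ f g : Lp ℂ 2 μ, Tendsto (fun n => inner ℂ (M n f) g) atTop (𝓝 (inner ℂ f g)) := by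
    intro f g
    simp_rw [fun n => inner_mulOp_left (hM n) f g]
    rw [L2.inner_def]
    refine tendsto_integral_of_dominated_convergence (fun x => ‖inner ℂ (f x) (g x)‖) ?_ ?_ ?_ ?_
    · exact fun n => (Complex.measurable_ofReal.comp (hχm n)).aestronglyMeasurable.mul
        (L2.integrable_inner f g).aestronglyMeasurable
    · exact (L2.integrable_inner f g).norm
    · refine fun n => Eventually.of_forall fun x => ?_
      rw [norm_mul, Complex.norm_real, Real.norm_eq_abs]
      exact mul_le_of_le_one_left (norm_nonneg _) (hχ n x)
    · refine Eventually.of_forall fun x => tendsto_const_nhds.congr' ?_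
      obtain ⟨N, hN⟩ := exists_nat_ge (max |ρ x| |(ρ x)⁻¹|)
      filter_upwards [eventually_ge_atTop N] with n hn
      have hx : x ∈ S n := by
        have : (N : ℝ) ≤ n := by exact_mod_cast hn
        exact ⟨(le_max_left _ _).trans (hN.trans this), (le_max_right _ _).trans (hN.trans this)⟩
      simp [χ, hx]
  have hb : ∀ u v : ℕ → Lp ℂ 2 μ, ∀ n i, ‖M n (u i)‖ * ‖v i‖ ≤ ‖u i‖ * ‖v i‖ := fun u v n i =>
    mul_le_mul_of_nonneg_right (by simpa using norm_mulOp_le (hM n) (hχ n) (u i)) (norm_nonneg _)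
  have l1 := tendsto_seqDet (l := atTop) hs₁ (u := fun n i => M n (u₁ i)) (v := fun _ => v₁)
    (hb u₁ v₁) fun i j => hlim (u₁ i) (v₁ j)
  have l2 := tendsto_seqDet (l := atTop) hs₂ (u := fun n i => M n (u₂ i)) (v := fun _ => v₂)
    (hb u₂ v₂) fun i j => hlim (u₂ i) (v₂ j)
  simp only [heq] at l1
  exact tendsto_nhds_unique l1 l2

/-- A kernel with a trace-class conjugate has a well-defined Fredholm determinant. -/
theorem fredholmDetWellDefined_of_exists {k : X → X → ℂ}
    (h : ∃ T : Lp ℂ 2 μ →L[ℂ] Lp ℂ 2 μ, IsTraceClassConjugate T k) :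
    FredholmDetWellDefined μ k := by
  refine ⟨h, ?_⟩
  obtain ⟨T, ⟨k₁, ⟨ρ₁, hρ₁, h0₁, hk₁⟩, hT⟩, u, v, huv, hs⟩ := h
  refine ⟨seqDet fun n m => inner ℂ (u n) (v m), ?_, ?_⟩
  · rintro T' ⟨⟨k₂, ⟨ρ₂, hρ₂, h0₂, hk₂⟩, hT'⟩, u', v', huv', hs'⟩
    have : (seqDet fun n m => inner ℂ (u n) (v m)) = seqDet fun n m => inner ℂ (u' n) (v' m) := by
      -- Two conjugates of `k` differ by the quotient of their weights.
      refine seqDet_eq_of_conjugate (ρ := fun p => ρ₂ p / ρ₁ p) (hρ₂.div hρ₁)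
        (fun p => div_ne_zero (h0₂ p) (h0₁ p)) (fun p q => ?_) hT hT' huv huv' hs hs'
      rw [hk₁, hk₂]
      have e1 : (ρ₁ p : ℂ) ≠ 0 := Complex.ofReal_ne_zero.2 (h0₁ p)
      have e2 : (ρ₁ q : ℂ) ≠ 0 := Complex.ofReal_ne_zero.2 (h0₁ q)
      have e3 : (ρ₂ q : ℂ) ≠ 0 := Complex.ofReal_ne_zero.2 (h0₂ q)
      push_cast
      field_simp
    rw [this]
    exact hasFredholmDet_seqDet huv' hs'
  · intro d hd
    exact (hd T ⟨⟨k₁, ⟨ρ₁, hρ₁, h0₁, hk₁⟩, hT⟩, u, v, huv, hs⟩).unique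
      (hasFredholmDet_seqDet huv hs)

end Conjugation
end AiryTransition

namespace AiryTransition

/-! ### Hilbert–Schmidt integral operators -/

section HilbertSchmidt

variable {X Ω : Type} [MeasurableSpace X] [MeasurableSpace Ω] {μ : Measure X} {ν : Measure Ω}

theorem L2_norm_sq (f : Lp ℂ 2 μ) : ‖f‖ ^ 2 = ∫ x, ‖f x‖ ^ 2 ∂μ := by
  have h : ((‖f‖ ^ 2 : ℝ) : ℂ) = ((∫ x, ‖f x‖ ^ 2 ∂μ : ℝ) : ℂ) := by
    rw [← integral_complex_ofReal]
    push_cast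
    refine (inner_self_eq_norm_sq_to_K (𝕜 := ℂ) f).symm.trans ?_
    rw [L2.inner_def]
    refine integral_congr_ae (Eventually.of_forall fun x => ?_)
    exact inner_self_eq_norm_sq_to_K (𝕜 := ℂ) (f x)
  exact_mod_cast h

theorem L2_integrable_norm_sq (f : Lp ℂ 2 μ) : Integrable (fun x => ‖f x‖ ^ 2) μ :=
  (memLp_two_iff_integrable_sq_norm (Lp.aestronglyMeasurable f)).1 (Lp.memLp f)

/-- The `L²` vector representing the functional `g ↦ ∫ h g`. -/
theorem exists_riesz {h : Ω → ℂ} (hh : MemLp h 2 ν) :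
    ∃ r : Lp ℂ 2 ν, (r =ᵐ[ν] fun t => (starRingEnd ℂ) (h t)) ∧
      (∀ g : Lp ℂ 2 ν, inner ℂ r g = ∫ t, h t * g t ∂ν) ∧ ‖r‖ ^ 2 = ∫ t, ‖h t‖ ^ 2 ∂ν := by
  have hc : (hh.star.toLp _ : Lp ℂ 2 ν) =ᵐ[ν] fun t => (starRingEnd ℂ) (h t) := hh.star.coeFn_toLp
  refine ⟨hh.star.toLp _, hc, fun g => ?_, ?_⟩
  · rw [L2.inner_def]
    refine integral_congr_ae ?_
    filter_upwards [hc] with t ht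
    rw [ht]
    simp [mul_comm]
  · rw [L2_norm_sq]
    refine integral_congr_ae ?_
    filter_upwards [hc] with t ht
    rw [ht]
    simp

variable [SFinite μ] [SFinite ν]

theorem ae_memLp_slice {a : X → Ω → ℂ} (ha : MemLp (Function.uncurry a) 2 (μ.prod ν)) :
    ∀ᵐ p ∂μ, MemLp (a p) 2 ν := by
  have h2 := (memLp_two_iff_integrable_sq_norm ha.1).1 ha
  filter_upwards [h2.prod_right_ae, ha.1.prodMk_left] with p h3 h4
  exact (memLp_two_iff_integrable_sq_norm h4).2 h3

/-- Hilbert–Schmidt integral operators. -/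
theorem exists_hilbertSchmidt {a : X → Ω → ℂ} (ha : MemLp (Function.uncurry a) 2 (μ.prod ν)) :
    ∃ A : Lp ℂ 2 ν →L[ℂ] Lp ℂ 2 μ,
      (∀ g, ∀ᵐ p ∂μ, A g p = ∫ t, a p t * g t ∂ν) ∧
      ∀ (ι : Type) (e : ι → Lp ℂ 2 ν), Orthonormal ℂ e → Summable fun i => ‖A (e i)‖ ^ 2 := by
  have hsl := ae_memLp_slice ha
  have h2 := (memLp_two_iff_integrable_sq_norm ha.1).1 ha
  have hN : Integrable (fun p => ∫ t, ‖a p t‖ ^ 2 ∂ν) μ := h2.integral_prod_left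
  have hpt : ∀ᵐ p ∂μ, ∀ g : Lp ℂ 2 ν,
      ‖∫ t, a p t * g t ∂ν‖ ^ 2 ≤ (∫ t, ‖a p t‖ ^ 2 ∂ν) * ‖g‖ ^ 2 := by
    filter_upwards [hsl] with p hp g
    obtain ⟨r, -, hr, hn⟩ := exists_riesz hp
    rw [← hr, ← hn, ← mul_pow]
    exact pow_le_pow_left₀ (norm_nonneg _) (norm_inner_le_norm _ _) 2
  have hmeas : ∀ g : Lp ℂ 2 ν, AEStronglyMeasurable (fun p => ∫ t, a p t * g t ∂ν) μ := fun g =>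
    AEStronglyMeasurable.integral_prod_right' (f := fun z : X × Ω => a z.1 z.2 * g z.2)
      (ha.1.mul ((Lp.aestronglyMeasurable g).comp_snd))
  have hmem : ∀ g : Lp ℂ 2 ν, MemLp (fun p => ∫ t, a p t * g t ∂ν) 2 μ := fun g => by
    refine (memLp_two_iff_integrable_sq_norm (hmeas g)).2 ?_
    refine Integrable.mono' (hN.mul_const (‖g‖ ^ 2)) ((hmeas g).norm.pow 2) ?_
    filter_upwards [hpt] with p hp
    rw [Real.norm_of_nonneg (by positivity)]
    exact hp g
  let A₀ : Lp ℂ 2 ν →ₗ[ℂ] Lp ℂ 2 μ :=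
    { toFun := fun g => (hmem g).toLp _
      map_add' := fun f g => by
        ext1
        filter_upwards [(hmem (f + g)).coeFn_toLp, (hmem f).coeFn_toLp, (hmem g).coeFn_toLp, hsl,
          Lp.coeFn_add ((hmem f).toLp _) ((hmem g).toLp _)] with p e1 e2 e3 e4 e5
        obtain ⟨r, -, hr, -⟩ := exists_riesz e4
        rw [e1, e5, Pi.add_apply, e2, e3, ← hr, ← hr, ← hr, inner_add_right]
      map_smul' := fun c f => by
        ext1
        filter_upwards [(hmem (c • f)).coeFn_toLp, (hmem f).coeFn_toLp, hsl,
          Lp.coeFn_smul c ((hmem f).toLp _)] with p e1 e2 e4 e5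
        obtain ⟨r, -, hr, -⟩ := exists_riesz e4
        rw [e1, RingHom.id_apply, e5, Pi.smul_apply, e2, ← hr, ← hr, inner_smul_right,
          smul_eq_mul] }
  have hA₀ : ∀ g, ∀ᵐ p ∂μ, A₀ g p = ∫ t, a p t * g t ∂ν := fun g => (hmem g).coeFn_toLp
  have hb : ∀ g, ‖A₀ g‖ ≤ √(∫ p, ∫ t, ‖a p t‖ ^ 2 ∂ν ∂μ) * ‖g‖ := by
    intro g
    refine le_of_sq_le_sq ?_ (by positivity)
    rw [mul_pow, Real.sq_sqrt (by positivity), L2_norm_sq, ← integral_mul_const]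
    refine integral_mono_ae (L2_integrable_norm_sq _) (hN.mul_const _) ?_
    filter_upwards [hA₀ g, hpt] with p e1 e2
    rw [e1]
    exact e2 g
  refine ⟨A₀.mkContinuous _ hb, hA₀, fun ι e he => ?_⟩
  -- Bessel's inequality for the slice `a p`, integrated over `p`.
  refine summable_of_sum_le (c := ∫ p, ∫ t, ‖a p t‖ ^ 2 ∂ν ∂μ) (fun i => by positivity) fun s => ?_
  change ∑ i ∈ s, ‖A₀ (e i)‖ ^ 2 ≤ _
  simp_rw [L2_norm_sq]
  rw [← integral_finsetSum _ fun i _ => L2_integrable_norm_sq _]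
  refine integral_mono_ae (integrable_finsetSum _ fun i _ => L2_integrable_norm_sq _) hN ?_
  have hall : ∀ᵐ p ∂μ, ∀ i ∈ s, A₀ (e i) p = ∫ t, a p t * e i t ∂ν :=
    (Finset.eventually_all s).2 fun i _ => hA₀ (e i)
  filter_upwards [hall, hsl] with p e1 e2
  obtain ⟨r, -, hr, hn⟩ := exists_riesz e2
  rw [← hn]
  refine le_trans (Finset.sum_le_sum fun i hi => ?_) (he.sum_inner_products_le r (s := s))
  rw [e1 i hi, ← hr, norm_inner_symm]

end HilbertSchmidt

/-! ### Nuclear kernels and products of Hilbert–Schmidt kernels -/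

section TraceClass

/-- Nuclear expansions over an arbitrary index type. -/
theorem isTraceClass_of_hasSum {H : Type} [NormedAddCommGroup H] [InnerProductSpace ℂ H]
    {ι : Type*} {T : H →L[ℂ] H} {u v : ι → H} (huv : Summable fun i => ‖u i‖ * ‖v i‖)
    (hT : ∀ f, HasSum (fun i => inner ℂ (u i) f • v i) (T f)) : IsTraceClass T := by
  -- A summable family has countable support, so the nonzero terms can be indexed by part of `ℕ` and
  -- the remaining indices filled with zeros.
  let S := Function.support fun i => ‖u i‖ * ‖v i‖
  have : Countable S := huv.countable_support
  obtain ⟨φ, hφ⟩ := exists_injective_nat S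
  let u' : S → H := fun i => u i
  let v' : S → H := fun i => v i
  have hu : ∀ i, Function.extend φ u' 0 (φ i) = u i := fun i => hφ.extend_apply _ _ _
  have hv : ∀ i, Function.extend φ v' 0 (φ i) = v i := fun i => hφ.extend_apply _ _ _
  have h0 : ∀ n ∉ Set.range φ, Function.extend φ v' 0 n = 0 := fun n hn =>
    Function.extend_apply' _ _ _ fun ⟨i, hi⟩ => hn ⟨i, hi⟩
  refine ⟨Function.extend φ u' 0, Function.extend φ v' 0, ?_, fun f => ?_⟩
  · refine (hφ.summable_iff fun n hn => ?_).1 ?_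
    · rw [h0 n hn]; simp
    · simp only [Function.comp_def, hu, hv]
      exact huv.subtype S
  · refine (hφ.hasSum_iff fun n hn => ?_).1 ?_
    · rw [h0 n hn, smul_zero]
    · have : Function.support (fun i => inner ℂ (u i) f • v i) ⊆ S := by
        intro i hi
        simp only [Function.mem_support, ne_eq, smul_eq_zero, not_or] at hi
        have h1 : u i ≠ 0 := fun h => hi.1 (by rw [h, inner_zero_left])
        exact mul_ne_zero (norm_ne_zero_iff.2 h1) (norm_ne_zero_iff.2 hi.2)
      simpa [Function.comp_def, hu, hv] using (hasSum_subtype_iff_of_support_subset this).2 (hT f)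

theorem IsTraceClass.add {H : Type} [NormedAddCommGroup H] [InnerProductSpace ℂ H]
    {T S : H →L[ℂ] H} (hT : IsTraceClass T) (hS : IsTraceClass S) : IsTraceClass (T + S) := by
  obtain ⟨u, v, h1, h2⟩ := hT
  obtain ⟨u', v', h1', h2'⟩ := hS
  refine isTraceClass_of_hasSum (ι := ℕ ⊕ ℕ) (u := Sum.elim u u') (v := Sum.elim v v') ?_ ?_
  · exact (HasSum.sum (f := fun i : ℕ ⊕ ℕ => ‖Sum.elim u u' i‖ * ‖Sum.elim v v' i‖)
      h1.hasSum h1'.hasSum).summable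
  · exact fun f => HasSum.sum (f := fun i : ℕ ⊕ ℕ => inner ℂ (Sum.elim u u' i) f • Sum.elim v v' i)
      (h2 f) (h2' f)

variable {X : Type} [MeasurableSpace X] {μ : Measure X}

/-- `k` is the kernel of a trace-class operator. -/
def IsNuclearKernel (μ : Measure X) (k : X → X → ℂ) : Prop :=
  ∃ T : Lp ℂ 2 μ →L[ℂ] Lp ℂ 2 μ, HasKernel T k ∧ IsTraceClass T

theorem IsNuclearKernel.zero : IsNuclearKernel μ fun _ _ => 0 := by
  refine ⟨0, fun f => ?_, fun _ => 0, fun _ => 0, by simp,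
    fun f => by simp⟩
  filter_upwards [Lp.coeFn_zero ℂ 2 μ] with p hp
  simpa using hp

theorem IsNuclearKernel.add {k l : X → X → ℂ} (hk : IsNuclearKernel μ k)
    (hl : IsNuclearKernel μ l) : IsNuclearKernel μ fun p q => k p q + l p q := by
  obtain ⟨T, hT, hT'⟩ := hk
  obtain ⟨S, hS, hS'⟩ := hl
  refine ⟨T + S, fun f => ?_, hT'.add hS'⟩
  filter_upwards [hT f, hS f, Lp.coeFn_add (T f) (S f)] with p h1 h2 h3
  simp only [add_mul]
  refine ⟨h1.1.add h2.1, ?_⟩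
  rw [integral_add h1.1 h2.1, ← h1.2, ← h2.2]
  exact h3

theorem IsNuclearKernel.sum {ι : Type*} (s : Finset ι) {k : ι → X → X → ℂ}
    (hk : ∀ i ∈ s, IsNuclearKernel μ (k i)) : IsNuclearKernel μ fun p q => ∑ i ∈ s, k i p q := by
  classical
  induction s using Finset.induction_on with
  | empty => simpa using IsNuclearKernel.zero
  | insert i s hi ih =>
    simp only [Finset.sum_insert hi]
    exact (hk i (by simp)).add (ih fun j hj => hk j (by simp [hj]))

/-- A kernel that is a product of two Hilbert–Schmidt kernels is nuclear. -/
theorem isNuclearKernel_of_factor {Ω : Type} [MeasurableSpace Ω] {ν : Measure Ω} [SFinite μ]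
    [SFinite ν] {a c : X → Ω → ℂ}
    (ha : MemLp (Function.uncurry a) 2 (μ.prod ν)) (hc : MemLp (Function.uncurry c) 2 (μ.prod ν)) :
    IsNuclearKernel μ fun p q => ∫ t, a p t * c q t ∂ν := by
  obtain ⟨A, hA, hAs⟩ := exists_hilbertSchmidt ha
  -- The kernel is conjugated here so that the adjoint of `C` integrates against `c` itself.
  obtain ⟨C, hC, hCs⟩ := exists_hilbertSchmidt (a := fun q t => (starRingEnd ℂ) (c q t)) hc.star
  obtain ⟨w, b, -⟩ := exists_hilbertBasis ℂ (Lp ℂ 2 ν)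
  refine ⟨A ∘L ContinuousLinearMap.adjoint C, fun f => ?_,
    isTraceClass_of_hasSum (u := fun i => C (b i)) (v := fun i => A (b i)) ?_ fun f => ?_⟩
  · filter_upwards [hA (ContinuousLinearMap.adjoint C f), ae_memLp_slice ha] with p h1 h2
    obtain ⟨r, hr, hr', -⟩ := exists_riesz h2
    have hk : (fun q => inner ℂ (C r q) (f q)) =ᵐ[μ] fun q => (∫ t, a p t * c q t ∂ν) * f q := by
      filter_upwards [hC r] with q hq
      rw [hq]
      simp only [RCLike.inner_apply]
      rw [← integral_conj, mul_comm]
      congr 1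
      refine integral_congr_ae ?_
      filter_upwards [hr] with t ht
      rw [ht]
      simp [mul_comm]
    refine ⟨(L2.integrable_inner (C r) f).congr hk, ?_⟩
    rw [← integral_congr_ae hk, ← L2.inner_def, ← ContinuousLinearMap.adjoint_inner_right, hr']
    exact h1
  · refine Summable.of_nonneg_of_le (fun i => by positivity) (fun i => ?_)
      ((hCs w b b.orthonormal).add (hAs w b b.orthonormal))
    nlinarith [sq_nonneg (‖C (b i)‖ - ‖A (b i)‖), sq_nonneg ‖C (b i)‖, sq_nonneg ‖A (b i)‖]
  -- Inserting a Hilbert basis between the two factors gives `T f = ∑ ⟨C bᵢ, f⟩ A bᵢ`.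
  · have := (b.hasSum_repr (ContinuousLinearMap.adjoint C f)).mapL A
    simpa [b.repr_apply_apply, ContinuousLinearMap.adjoint_inner_right] using this

end TraceClass
end AiryTransition

namespace AiryTransition

/-! ### Exponential bounds for the Airy function by a contour shift -/

section AiryBound

/-- A cubic with negative leading coefficient is dominated by a decreasing linear function. -/
theorem exists_cubic_le {κ : ℝ} (hκ : 0 < κ) (B : ℝ) :
    ∃ C : ℝ, ∀ r : ℝ, 0 ≤ r → -κ * r ^ 3 + B * r ^ 2 + B * r ≤ C - r := by
  -- Beyond `R` one has `r ≥ 1` and `κ r ≥ 2|B| + 1`, so the cubic term alone beats all the others.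
  set R := 1 + (2 * |B| + 1) / κ
  have hR : 0 ≤ R := by positivity
  refine ⟨|B| * R ^ 2 + (|B| + 1) * R, fun r hr => ?_⟩
  have hB := le_abs_self B
  have hB0 := abs_nonneg B
  have h1 : B * r ^ 2 ≤ |B| * r ^ 2 := by gcongr
  have h2 : B * r ≤ |B| * r := by gcongr
  rcases le_total r R with h | h
  · have h3 : |B| * r ^ 2 ≤ |B| * R ^ 2 := by gcongr
    have h4 : (|B| + 1) * r ≤ (|B| + 1) * R := by gcongr
    have h5 : 0 ≤ κ * r ^ 3 := by positivity
    linarith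
  · have h3 : 2 * |B| + 1 ≤ κ * r := by
      have : (2 * |B| + 1) / κ ≤ r := by simp only [R] at h; linarith
      rw [div_le_iff₀ hκ] at this
      linarith
    have h4 : 1 ≤ r := by
      have : 0 ≤ (2 * |B| + 1) / κ := by positivity
      simp only [R] at h; linarith
    have h5 : (2 * |B| + 1) * r ^ 2 ≤ κ * r * r ^ 2 := by gcongr
    have h6 : (|B| + 1) * r ≤ (|B| + 1) * r ^ 2 := by
      gcongr
      nlinarith
    have h7 : 0 ≤ |B| * R ^ 2 + (|B| + 1) * R := by positivity
    linarith

/-- The integrand of the Airy function on a ray `u ℝ₊` with `u³ = -1`, `Re u = 1/2`. -/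
theorem norm_airy_ray (x r : ℝ) {u : ℂ} (hu : u ^ 3 = -1) (hre : u.re = 1 / 2) :
    ‖Complex.exp ((r * u) ^ 3 / 3 - x * (r * u))‖ = Real.exp (-(1 / 3) * r ^ 3 - x / 2 * r) := by
  rw [Complex.norm_exp]
  congr 1
  have : ((r * u) ^ 3 / 3 - x * (r * u) : ℂ) =
      ((-(1 / 3) * r ^ 3 : ℝ) : ℂ) - ((x * r : ℝ) : ℂ) * u := by
    rw [mul_pow, hu]; push_cast; ring
  rw [this, Complex.sub_re, Complex.re_ofReal_mul, hre, Complex.ofReal_re]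
  ring

theorem integrableOn_airy_ray (x : ℝ) {u : ℂ} (hu : u ^ 3 = -1) (hre : u.re = 1 / 2) :
    IntegrableOn (fun r : ℝ => Complex.exp ((r * u) ^ 3 / 3 - x * (r * u)) * u) (Set.Ioi 0) := by
  obtain ⟨C, hC⟩ := exists_cubic_le (κ := 1 / 3) (by norm_num) (|x| / 2)
  refine Integrable.mono' (((integrableOn_exp_neg_Ioi 0).const_mul (Real.exp C)).mul_const ‖u‖) ?_ ?_
  · exact Continuous.aestronglyMeasurable (by fun_prop)
  · refine (ae_restrict_iff' measurableSet_Ioi).2 (Eventually.of_forall fun r hr => ?_)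
    have hr : 0 < r := hr
    rw [norm_mul, norm_airy_ray x r hu hre, ← Real.exp_add]
    refine mul_le_mul_of_nonneg_right (Real.exp_le_exp.2 ?_) (norm_nonneg _)
    have h1 := hC r hr.le
    have h2 : -x / 2 * r ≤ |x| / 2 * r := by
      gcongr; exact neg_le_abs x
    have h3 : 0 ≤ |x| / 2 * r ^ 2 := by positivity
    linarith

theorem cube_exp_pi_div_three : Complex.exp ((Real.pi / 3 : ℝ) * Complex.I) ^ 3 = -1 := by
  rw [← Complex.exp_nat_mul, ← Complex.exp_pi_mul_I]
  congr 1; push_cast; ring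

theorem conj_exp_mul_I (φ : ℝ) :
    Complex.exp (-(φ * Complex.I)) = (starRingEnd ℂ) (Complex.exp (φ * Complex.I)) := by
  rw [← Complex.exp_conj]; simp

/-- Working with an entire primitive `F` replaces Cauchy's theorem: moving a path means splitting a
difference of values of `F`. -/
theorem norm_primitive_sub_le {f F : ℂ → ℂ} (hF : ∀ z, HasDerivAt F (f z) z) {z w : ℂ} {C : ℝ}
    (h : ∀ y ∈ segment ℝ z w, ‖f y‖ ≤ C) : ‖F w - F z‖ ≤ C * ‖w - z‖ :=
  (convex_segment z w).norm_image_sub_le_of_norm_hasDerivWithin_le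
    (fun y _ => (hF y).hasDerivWithinAt) h (left_mem_segment ℝ z w) (right_mem_segment ℝ z w)

theorem norm_airy_line (x t y : ℝ) :
    ‖Complex.exp ((t + y * Complex.I) ^ 3 / 3 - x * (t + y * Complex.I))‖ =
      Real.exp (t ^ 3 / 3 - t * y ^ 2 - x * t) := by
  rw [Complex.norm_exp]
  congr 1
  have : ((t + y * Complex.I) ^ 3 / 3 - x * (t + y * Complex.I) : ℂ) =
      ((t ^ 3 / 3 - t * y ^ 2 - x * t : ℝ) : ℂ) +
        ((t ^ 2 * y - y ^ 3 / 3 - x * y : ℝ) : ℂ) * Complex.I := by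
    push_cast
    linear_combination (t * y ^ 2 + y ^ 3 / 3 * Complex.I : ℂ) * Complex.I_sq
  rw [this]
  simp [-Complex.ofReal_sub, -Complex.ofReal_add, -Complex.ofReal_mul, -Complex.ofReal_pow, -Complex.ofReal_div]

/-- The part of the shifted contour on a horizontal segment. -/
theorem norm_airy_horizontal_le {F : ℂ → ℂ} {x δ R : ℝ}
    (hF : ∀ z, HasDerivAt F (Complex.exp (z ^ 3 / 3 - x * z)) z) (hδ : 0 < δ) (hR : 2 * δ ≤ R)
    {u : ℂ} (hre : u.re = 1 / 2) (him : u.im ^ 2 = 3 / 4) :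
    ‖F (R * u) - F (δ + ((R * u.im : ℝ) : ℂ) * Complex.I)‖ ≤
      Real.exp (-(2 / 3) * δ * R ^ 2 + |x| * R) * R := by
  set Y := R * u.im
  have hY : Y ^ 2 = 3 / 4 * R ^ 2 := by simp only [Y, mul_pow, him]; ring
  have hRu : (R * u : ℂ) = ((R / 2 : ℝ) : ℂ) + (Y : ℂ) * Complex.I := by
    apply Complex.ext <;> simp [hre, Y]; ring
  have hdiff : (((R / 2 : ℝ) : ℂ) + (Y : ℂ) * Complex.I) - (δ + (Y : ℂ) * Complex.I) =
      ((R / 2 - δ : ℝ) : ℂ) := by push_cast; ring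
  rw [hRu]
  refine (norm_primitive_sub_le hF (C := Real.exp (-(2 / 3) * δ * R ^ 2 + |x| * R)) ?_).trans ?_
  · rintro y ⟨p, q, hp, hq, hpq, rfl⟩
    have hy : (p • (δ + (Y : ℂ) * Complex.I) + q • (((R / 2 : ℝ) : ℂ) + (Y : ℂ) * Complex.I)) =
        ((p * δ + q * (R / 2) : ℝ) : ℂ) + (Y : ℂ) * Complex.I := by
      have : (p : ℂ) + q = 1 := by exact_mod_cast hpq
      simp only [Complex.real_smul]
      push_cast
      linear_combination (Y : ℂ) * Complex.I * this
    rw [hy, norm_airy_line]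
    set t := p * δ + q * (R / 2)
    have ht1 : δ ≤ t := by
      have hp' : p = 1 - q := by linarith
      simp only [t, hp']; nlinarith
    have ht2 : t ≤ R / 2 := by
      have hp' : q = 1 - p := by linarith
      simp only [t, hp']; nlinarith
    have ht0 : 0 ≤ t := by linarith
    refine Real.exp_le_exp.2 ?_
    have h1 : t ^ 2 ≤ R ^ 2 / 4 := by nlinarith
    -- With `t ≤ R/2` and `Y² = 3R²/4`: `1/12 - 3/4 = -2/3`.
    have h2 : t ^ 3 / 3 - t * Y ^ 2 ≤ -(2 / 3) * t * R ^ 2 := by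
      rw [hY]; nlinarith
    have h3 : δ * R ^ 2 ≤ t * R ^ 2 := by gcongr
    have h4 : -x * t ≤ |x| * R := by
      refine (mul_le_mul_of_nonneg_right (neg_le_abs x) ht0).trans ?_
      gcongr; linarith
    linarith
  · rw [hdiff, Complex.norm_real, Real.norm_of_nonneg (by linarith)]
    gcongr
    linarith

theorem tendsto_airy_horizontal (x : ℝ) {δ : ℝ} (hδ : 0 < δ) :
    Tendsto (fun R : ℝ => Real.exp (-(2 / 3) * δ * R ^ 2 + |x| * R) * R) atTop (𝓝 0) := by
  have h := Real.tendsto_pow_mul_exp_neg_atTop_nhds_zero 1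
  refine squeeze_zero' ?_ ?_ h
  · filter_upwards [eventually_ge_atTop 0] with R hR
    positivity
  · filter_upwards [eventually_ge_atTop 0, eventually_ge_atTop ((|x| + 1) / (2 / 3 * δ))]
      with R hR h1
    rw [pow_one, mul_comm]
    gcongr
    rw [div_le_iff₀ (by positivity)] at h1
    nlinarith

/-- The Airy function is `O(exp (-δ x))` on the real line for every `δ > 0`. -/
theorem exists_norm_airyAi_le {δ : ℝ} (hδ : 0 < δ) :
    ∃ C : ℝ, 0 ≤ C ∧ ∀ x : ℝ, ‖airyAi x‖ ≤ C * Real.exp (-δ * x) := by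
  set J := ∫ y : ℝ, Real.exp (-δ * y ^ 2)
  have hJ : Integrable fun y : ℝ => Real.exp (-δ * y ^ 2) := integrable_exp_neg_mul_sq hδ
  refine ⟨‖(2 * Real.pi * Complex.I : ℂ)⁻¹‖ * (Real.exp (δ ^ 3 / 3) * J), ?_, fun x => ?_⟩
  · have : 0 ≤ J := integral_nonneg fun y => (Real.exp_pos _).le
    positivity
  have hdf : Differentiable ℂ fun w : ℂ => Complex.exp (w ^ 3 / 3 - x * w) := by fun_prop
  obtain ⟨F, hF⟩ := hdf.isExactOn_univ
  have hF : ∀ z, HasDerivAt F (Complex.exp (z ^ 3 / 3 - x * z)) z := fun z => hF z (Set.mem_univ z)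
  set u := Complex.exp ((Real.pi / 3 : ℝ) * Complex.I) with hu
  have hu3 : u ^ 3 = -1 := cube_exp_pi_div_three
  have hure : u.re = 1 / 2 := by
    rw [hu, Complex.exp_ofReal_mul_I_re, Real.cos_pi_div_three]
  have huim : u.im ^ 2 = 3 / 4 := by
    rw [hu, Complex.exp_ofReal_mul_I_im, Real.sin_pi_div_three, div_pow, Real.sq_sqrt] <;> norm_num
  set v := (starRingEnd ℂ) u
  have hv3 : v ^ 3 = -1 := by rw [← map_pow, hu3]; simp
  have hvre : v.re = 1 / 2 := by simp [v, hure]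
  have hvim : v.im ^ 2 = 3 / 4 := by simp [v, huim]
  have hvu : v.im = -u.im := by simp [v]
  have hw : wedgeIntegral 0 (Real.pi / 3) (fun w => Complex.exp (w ^ 3 / 3 - x * w)) =
      ∫ r in Set.Ioi (0 : ℝ), (Complex.exp ((r * u) ^ 3 / 3 - x * (r * u)) * u -
        Complex.exp ((r * v) ^ 3 / 3 - x * (r * v)) * v) := by
    simp only [wedgeIntegral, conj_exp_mul_I]
    simp [u, v]
  have hint := (integrableOn_airy_ray x hu3 hure).sub (integrableOn_airy_ray x hv3 hvre)
  have hlim := intervalIntegral_tendsto_integral_Ioi 0 hint tendsto_id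
  have hFu : ∀ (c : ℂ) (R : ℝ), HasDerivAt (fun r : ℝ => F (r * c))
      (Complex.exp ((R * c) ^ 3 / 3 - x * (R * c)) * c) R := by
    intro c R
    have h1 : HasDerivAt (fun r : ℝ => (r : ℂ) * c) c R := by
      simpa using (Complex.ofRealCLM.hasDerivAt (x := R)).mul_const c
    exact (hF (R * c)).comp R h1
  have htr : ∀ R : ℝ, ∫ r in (0 : ℝ)..R, (Complex.exp ((r * u) ^ 3 / 3 - x * (r * u)) * u -
        Complex.exp ((r * v) ^ 3 / 3 - x * (r * v)) * v) = F (R * u) - F (R * v) := by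
    intro R
    rw [intervalIntegral.integral_eq_sub_of_hasDerivAt
      (f := fun r : ℝ => F (r * u) - F (r * v)) (fun r _ => (hFu u r).sub (hFu v r))
      (Continuous.intervalIntegrable (by fun_prop) _ _)]
    simp
  -- On the line `Re w = δ` the integrand has modulus `exp (δ³/3 - δ y² - δ x)`: the bound is
  -- uniform in the height and carries the factor `exp (-δ x)`.
  have hvert : ∀ Y : ℝ, ‖F (δ + Y * Complex.I) - F (δ + ((-Y : ℝ) : ℂ) * Complex.I)‖ ≤
      Real.exp (δ ^ 3 / 3) * J * Real.exp (-δ * x) := by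
    intro Y
    have h1 : ∀ y : ℝ, HasDerivAt (fun y : ℝ => F (δ + y * Complex.I))
        (Complex.exp ((δ + y * Complex.I) ^ 3 / 3 - x * (δ + y * Complex.I)) * Complex.I) y := by
      intro y
      have h2 : HasDerivAt (fun y : ℝ => (δ : ℂ) + y * Complex.I) Complex.I y := by
        simpa using ((Complex.ofRealCLM.hasDerivAt (x := y)).mul_const Complex.I).const_add (δ : ℂ)
      exact (hF _).comp y h2
    rw [← intervalIntegral.integral_eq_sub_of_hasDerivAt (fun y _ => h1 y)
      (Continuous.intervalIntegrable (by fun_prop) _ _)]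
    have h3 : ∀ y : ℝ,
        ‖Complex.exp ((δ + y * Complex.I) ^ 3 / 3 - x * (δ + y * Complex.I)) * Complex.I‖ =
        Real.exp (δ ^ 3 / 3) * Real.exp (-δ * x) * Real.exp (-δ * y ^ 2) := by
      intro y
      rw [norm_mul, Complex.norm_I, mul_one, norm_airy_line, ← Real.exp_add, ← Real.exp_add]
      congr 1; ring
    refine intervalIntegral.norm_integral_le_integral_norm_uIoc.trans ?_
    simp_rw [h3]
    rw [integral_const_mul]
    calc _ ≤ Real.exp (δ ^ 3 / 3) * Real.exp (-δ * x) * J := by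
          gcongr
          exact setIntegral_le_integral hJ (Eventually.of_forall fun y => (Real.exp_pos _).le)
      _ = _ := by ring
  -- The endpoints `R u` and `R v` are joined through the vertical line; the two horizontal pieces
  -- vanish as `R → ∞`.
  have hbound : ‖∫ r in Set.Ioi (0 : ℝ), (Complex.exp ((r * u) ^ 3 / 3 - x * (r * u)) * u -
        Complex.exp ((r * v) ^ 3 / 3 - x * (r * v)) * v)‖ ≤
      Real.exp (δ ^ 3 / 3) * J * Real.exp (-δ * x) + (0 + 0) := by
    refine le_of_tendsto_of_tendsto hlim.norm (tendsto_const_nhds.add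
      ((tendsto_airy_horizontal x hδ).add (tendsto_airy_horizontal x hδ))) ?_
    filter_upwards [eventually_ge_atTop (2 * δ)] with R hR
    have e1 := norm_airy_horizontal_le hF hδ hR hure huim
    have e2 := norm_airy_horizontal_le hF hδ hR hvre hvim
    have e3 := hvert (R * u.im)
    rw [hvu, mul_neg] at e2
    refine (congrArg norm (htr R)).trans_le ?_
    set P := F (δ + ((R * u.im : ℝ) : ℂ) * Complex.I)
    set Q := F (δ + ((-(R * u.im) : ℝ) : ℂ) * Complex.I)
    calc ‖F (R * u) - F (R * v)‖ = ‖(P - Q) + ((F (R * u) - P) - (F (R * v) - Q))‖ := by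
          congr 1; ring
      _ ≤ ‖P - Q‖ + (‖F (R * u) - P‖ + ‖F (R * v) - Q‖) :=
          (norm_add_le _ _).trans (by gcongr; exact norm_sub_le _ _)
      _ ≤ _ := by gcongr
  rw [airyAi, norm_mul, hw]
  rw [add_zero, add_zero] at hbound
  calc _ ≤ ‖(2 * Real.pi * Complex.I : ℂ)⁻¹‖ *
        (Real.exp (δ ^ 3 / 3) * J * Real.exp (-δ * x)) := by gcongr
    _ = _ := by ring

theorem measurable_airyAi : Measurable fun x : ℝ => airyAi x := by
  have h : StronglyMeasurable fun x : ℝ => wedgeIntegral 0 (Real.pi / 3)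
      (fun w => Complex.exp (w ^ 3 / 3 - x * w)) := by
    let f : ℝ × ℝ → ℂ → ℂ := fun z u =>
      Complex.exp (((0 : ℝ) + z.2 * u) ^ 3 / 3 - z.1 * ((0 : ℝ) + z.2 * u)) * u
    have hf : ∀ u, Continuous fun z => f z u := fun u => by fun_prop
    exact StronglyMeasurable.integral_prod_right' (f := fun z : ℝ × ℝ =>
      f z (Complex.exp ((Real.pi / 3 : ℝ) * Complex.I)) -
        f z (Complex.exp (-((Real.pi / 3 : ℝ) * Complex.I))))
      ((hf _).sub (hf _)).stronglyMeasurable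
  exact h.measurable.const_mul _

end AiryBound
end AiryTransition

namespace AiryTransition

/-! ### Nuclearity of cut kernels; the heat part -/

section CutKernels

variable {m : ℕ}

instance : SFinite (spaceMeasure m) := by unfold spaceMeasure; infer_instance

theorem memLp_exp_cut (s C : Fin m → ℝ) {κ : ℝ} (hκ : 0 < κ) :
    MemLp (fun p : Fin m × ℝ => if s p.1 < p.2 then C p.1 * Real.exp (-κ * p.2) else 0) 2
      (spaceMeasure m) := by
  have hmeas : Measurable fun p : Fin m × ℝ =>
      if s p.1 < p.2 then C p.1 * Real.exp (-κ * p.2) else 0 :=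
    Measurable.ite (measurableSet_lt ((measurable_of_finite s).comp measurable_fst) measurable_snd)
      (((measurable_of_finite C).comp measurable_fst).mul
        (Real.measurable_exp.comp (measurable_snd.const_mul _))) measurable_const
  rw [memLp_two_iff_integrable_sq hmeas.aestronglyMeasurable]
  refine (integrable_prod_iff (hmeas.pow_const 2).aestronglyMeasurable).2
    ⟨Eventually.of_forall fun i => ?_, Integrable.of_finite⟩
  have h1 : IntegrableOn (fun x : ℝ => C i ^ 2 * Real.exp (-(2 * κ) * x)) (Set.Ioi (s i)) :=
    (exp_neg_integrableOn_Ioi (s i) (by positivity)).const_mul _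
  refine (h1.integrable_indicator measurableSet_Ioi).congr (Eventually.of_forall fun x => ?_)
  by_cases hx : s i < x
  · simp only [Set.indicator, Set.mem_Ioi, hx, if_true]
    rw [mul_pow, ← Real.exp_nat_mul]
    congr 2; push_cast; ring
  · simp [hx]

variable {Ω : Type} [MeasurableSpace Ω] {ν : Measure Ω}

theorem memLp_of_exp_bound [SFinite ν] {s C : Fin m → ℝ} {κ : ℝ} (hκ : 0 < κ) {g : Ω → ℝ} (hg : MemLp g 2 ν)
    {α : Fin m × ℝ → Ω → ℂ} (hα : Measurable (Function.uncurry α))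
    (hb : ∀ᵐ t ∂ν, ∀ p, s p.1 < p.2 → ‖α p t‖ ≤ C p.1 * Real.exp (-κ * p.2) * g t) :
    MemLp (Function.uncurry fun p t => if s p.1 < p.2 then α p t else 0) 2
      ((spaceMeasure m).prod ν) := by
  have hf := memLp_exp_cut s C hκ
  have hfg : MemLp (fun z : (Fin m × ℝ) × Ω =>
      (if s z.1.1 < z.1.2 then C z.1.1 * Real.exp (-κ * z.1.2) else 0) * g z.2) 2
      ((spaceMeasure m).prod ν) := by
    refine (memLp_two_iff_integrable_sq (by exact hf.1.comp_fst.mul hg.1.comp_snd)).2 ?_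
    simpa only [mul_pow] using hf.integrable_sq.mul_prod hg.integrable_sq
  refine hfg.mono ?_ ?_
  · refine (Measurable.ite ?_ hα measurable_const).aestronglyMeasurable
    exact measurableSet_lt ((measurable_of_finite s).comp (measurable_fst.comp measurable_fst))
      (measurable_snd.comp measurable_fst)
  · filter_upwards [Measure.quasiMeasurePreserving_snd.ae hb] with z hz
    by_cases h : s z.1.1 < z.1.2
    · simp only [Function.uncurry, h, if_true]
      exact (hz z.1 h).trans (le_abs_self _)
    · simp [Function.uncurry, h]

/-- Cut kernels with exponentially decaying factors are nuclear. -/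
theorem isNuclearKernel_cut [SFinite ν] {s C C' : Fin m → ℝ} {κ κ' : ℝ} (hκ : 0 < κ) (hκ' : 0 < κ')
    {g g' : Ω → ℝ} (hg : MemLp g 2 ν) (hg' : MemLp g' 2 ν) {α β : Fin m × ℝ → Ω → ℂ}
    (hα : Measurable (Function.uncurry α)) (hβ : Measurable (Function.uncurry β))
    (hαb : ∀ᵐ t ∂ν, ∀ p, s p.1 < p.2 → ‖α p t‖ ≤ C p.1 * Real.exp (-κ * p.2) * g t)
    (hβb : ∀ᵐ t ∂ν, ∀ p, s p.1 < p.2 → ‖β p t‖ ≤ C' p.1 * Real.exp (-κ' * p.2) * g' t) :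
    IsNuclearKernel (spaceMeasure m) fun p q =>
      if s p.1 < p.2 ∧ s q.1 < q.2 then ∫ t, α p t * β q t ∂ν else 0 := by
  have := isNuclearKernel_of_factor (memLp_of_exp_bound hκ hg hα hαb)
    (memLp_of_exp_bound hκ' hg' hβ hβb)
  convert this using 3 with p q
  by_cases h1 : s p.1 < p.2 <;> by_cases h2 : s q.1 < q.2 <;> simp [h1, h2]

theorem memLp_exp_neg_sq {b : ℝ} (hb : 0 < b) : MemLp (fun x : ℝ => Real.exp (-b * x ^ 2)) 2 := by
  rw [memLp_two_iff_integrable_sq (Continuous.aestronglyMeasurable (by fun_prop))]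
  refine (integrable_exp_neg_mul_sq (b := 2 * b) (by positivity)).congr
    (Eventually.of_forall fun x => ?_)
  simp only
  rw [← Real.exp_nat_mul]
  congr 1; push_cast; ring

/-- The heat kernel as a superposition of rank-one kernels. -/
theorem integral_heat {t : ℝ} (ht : 0 < t) (h : ℝ) :
    ∫ ξ : ℝ, Complex.exp (-t * ξ ^ 2 + Complex.I * h * ξ) =
      (2 * Real.pi * (1 / √(4 * Real.pi * t) * Real.exp (-h ^ 2 / (4 * t))) : ℝ) := by
  have h1 := integral_cexp_quadratic (b := -t) (by simpa using ht) (Complex.I * h) 0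
  simp only [add_zero] at h1
  rw [h1]
  have h2 : (0 - (Complex.I * h) ^ 2 / (4 * (-t : ℂ))) = ((-h ^ 2 / (4 * t) : ℝ) : ℂ) := by
    have : (t : ℂ) ≠ 0 := by exact_mod_cast ht.ne'
    rw [mul_pow, Complex.I_sq]
    push_cast
    field_simp
    ring
  have h3 : ((Real.pi : ℂ) / -(-t : ℂ)) ^ (1 / 2 : ℂ) = ((√(Real.pi / t) : ℝ) : ℂ) := by
    rw [neg_neg, Real.sqrt_eq_rpow, Complex.ofReal_cpow (by positivity)]
    push_cast; rfl
  rw [h2, h3, ← Complex.ofReal_exp, ← Complex.ofReal_mul, ← mul_assoc]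
  congr 2
  have h4 : √(4 * Real.pi * t) = 2 * (√Real.pi * √t) := by
    rw [show 4 * Real.pi * t = 2 ^ 2 * (Real.pi * t) by ring, Real.sqrt_mul (by positivity),
      Real.sqrt_sq (by norm_num), Real.sqrt_mul Real.pi_pos.le]
  rw [h4, Real.sqrt_div Real.pi_pos.le]
  have h5 : √t ≠ 0 := (Real.sqrt_pos.2 ht).ne'
  have h6 : √Real.pi ≠ 0 := (Real.sqrt_pos.2 Real.pi_pos).ne'
  have h7 := Real.sq_sqrt Real.pi_pos.le
  field_simp
  linarith

/-- With `κ = (cⱼ - cᵢ)/2` and `d = -(cᵢ + cⱼ)/2` the weight splits as `cᵢ x - cⱼ y = -κ (x + y) - d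
(x - y)`. The factor in `x - y` is absorbed into the Gaussian by completing the square, which shifts
its argument by `2td`; the factor in `x + y` is the decay required. The Fourier representation then
separates `x` from `y`, each side receiving half of `exp (-t ξ²)`. -/
theorem isNuclearKernel_heat_pair {τ s : Fin m → ℝ} {c A : Fin m → ℝ} (i j : Fin m)
    (hτ : τ i < τ j) (hc : c i < c j) :
    IsNuclearKernel (spaceMeasure m) fun p q =>
      if p.1 = i ∧ q.1 = j then
        if s p.1 < p.2 ∧ s q.1 < q.2 then
          ((Real.exp (A p.1 + c p.1 * p.2) * heatTerm (τ p.1) p.2 (τ q.1) q.2 *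
            Real.exp (-(A q.1 + c q.1 * q.2)) : ℝ) : ℂ) else 0
      else 0 := by
  set t := τ j - τ i
  have ht : 0 < t := sub_pos.2 hτ
  set κ := (c j - c i) / 2
  have hκ : 0 < κ := by simp only [κ]; linarith
  set d := -(c i + c j) / 2
  set K : ℝ := -(1 / (2 * Real.pi)) *
    Real.exp (A i - A j + t * d ^ 2 + d * (min 0 (τ j) ^ 2 - min 0 (τ i) ^ 2))
  let α : Fin m × ℝ → ℝ → ℂ := fun p ξ => if p.1 = i then
    ((K * Real.exp (-κ * p.2) * Real.exp (-(t / 2) * ξ ^ 2) : ℝ) : ℂ) *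
      Complex.exp ((ξ * (sTilde (τ i) p.2 + t * d) : ℝ) * Complex.I) else 0
  let β : Fin m × ℝ → ℝ → ℂ := fun q ξ => if q.1 = j then
    ((Real.exp (-κ * q.2) * Real.exp (-(t / 2) * ξ ^ 2) : ℝ) : ℂ) *
      Complex.exp ((ξ * (-sTilde (τ j) q.2 + t * d) : ℝ) * Complex.I) else 0
  have hms : ∀ k : Fin m, MeasurableSet {z : (Fin m × ℝ) × ℝ | z.1.1 = k} := fun k =>
    (measurable_fst.comp measurable_fst) (measurableSet_singleton k)
  have hα : Measurable (Function.uncurry α) := by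
    refine Measurable.ite (hms i) ?_ measurable_const
    have : Continuous fun z : (Fin m × ℝ) × ℝ =>
      ((K * Real.exp (-κ * z.1.2) * Real.exp (-(t / 2) * z.2 ^ 2) : ℝ) : ℂ) *
      Complex.exp ((z.2 * (sTilde (τ i) z.1.2 + t * d) : ℝ) * Complex.I) := by
      unfold sTilde; fun_prop
    exact this.measurable
  have hβ : Measurable (Function.uncurry β) := by
    refine Measurable.ite (hms j) ?_ measurable_const
    have : Continuous fun z : (Fin m × ℝ) × ℝ =>
      ((Real.exp (-κ * z.1.2) * Real.exp (-(t / 2) * z.2 ^ 2) : ℝ) : ℂ) *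
      Complex.exp ((z.2 * (-sTilde (τ j) z.1.2 + t * d) : ℝ) * Complex.I) := by
      unfold sTilde; fun_prop
    exact this.measurable
  have hg := memLp_exp_neg_sq (b := t / 2) (by positivity)
  have key := isNuclearKernel_cut (s := s) (C := fun _ => |K|) (C' := fun _ => 1) hκ hκ hg hg
    hα hβ (Eventually.of_forall fun ξ p _ => ?_) (Eventually.of_forall fun ξ p _ => ?_)
  · convert key using 3 with p q
    by_cases hcut : s p.1 < p.2 ∧ s q.1 < q.2
    · rw [if_pos hcut, if_pos hcut]
      by_cases hpq : p.1 = i ∧ q.1 = j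
      · obtain ⟨rfl, rfl⟩ := hpq
        set h := sTilde (τ p.1) p.2 - sTilde (τ q.1) q.2 with hh
        have e1 : ∀ ξ : ℝ, α p ξ * β q ξ =
            ((K * Real.exp (-κ * p.2) * Real.exp (-κ * q.2) : ℝ) : ℂ) *
              Complex.exp (-t * ξ ^ 2 + Complex.I * ((h + 2 * t * d : ℝ) : ℂ) * ξ) := by
          intro ξ
          simp only [α, β, if_true]
          have : Complex.exp (-t * ξ ^ 2 + Complex.I * ((h + 2 * t * d : ℝ) : ℂ) * ξ) =
              (Real.exp (-(t / 2) * ξ ^ 2) : ℂ) * (Real.exp (-(t / 2) * ξ ^ 2) : ℂ) *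
              (Complex.exp ((ξ * (sTilde (τ p.1) p.2 + t * d) : ℝ) * Complex.I) *
              Complex.exp ((ξ * (-sTilde (τ q.1) q.2 + t * d) : ℝ) * Complex.I)) := by
            rw [Complex.ofReal_exp, ← Complex.exp_add, ← Complex.exp_add, ← Complex.exp_add]
            congr 1
            simp only [hh]
            push_cast
            ring
          rw [this]
          push_cast
          ring
        simp_rw [e1]
        rw [integral_const_mul, integral_heat ht, ← Complex.ofReal_mul]
        simp only [and_self, if_true]
        congr 1
        have hpi := Real.pi_pos.ne'
        rw [heatTerm, if_pos hτ]
        have e2 : Real.exp (A p.1 + c p.1 * p.2) * Real.exp (-(A q.1 + c q.1 * q.2)) *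
            Real.exp (-(sTilde (τ q.1) q.2 - sTilde (τ p.1) p.2) ^ 2 / (4 * t)) =
            Real.exp (A p.1 - A q.1 + t * d ^ 2 + d * (min 0 (τ q.1) ^ 2 - min 0 (τ p.1) ^ 2)) *
            Real.exp (-κ * p.2) * Real.exp (-κ * q.2) *
            Real.exp (-(h + 2 * t * d) ^ 2 / (4 * t)) := by
          simp only [← Real.exp_add]
          congr 1
          have e3 : -(h + 2 * t * d) ^ 2 / (4 * t) = -h ^ 2 / (4 * t) - h * d - t * d ^ 2 := by
            field_simp; ring
          have e4 : (sTilde (τ q.1) q.2 - sTilde (τ p.1) p.2) ^ 2 = h ^ 2 := by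
            rw [hh]; ring
          rw [e3, e4, hh]
          simp only [sTilde, κ, d]
          ring
        calc _ = -(1 / √(4 * Real.pi * t)) * (Real.exp (A p.1 + c p.1 * p.2) *
              Real.exp (-(A q.1 + c q.1 * q.2)) *
              Real.exp (-(sTilde (τ q.1) q.2 - sTilde (τ p.1) p.2) ^ 2 / (4 * t))) := by ring
          _ = _ := by
            rw [e2]
            simp only [K]
            field_simp
      · rw [if_neg hpq]
        have : ∀ ξ, α p ξ * β q ξ = 0 := by
          intro ξ
          by_cases h1 : p.1 = i
          · have h2 : q.1 ≠ j := fun h2 => hpq ⟨h1, h2⟩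
            simp [β, h2]
          · simp [α, h1]
        simp [this]
    · simp [hcut]
  · by_cases hp : p.1 = i
    · simp only [α, if_pos hp]
      rw [norm_mul, Complex.norm_exp_ofReal_mul_I, mul_one, Complex.norm_real, norm_mul, norm_mul,
        Real.norm_eq_abs, Real.norm_of_nonneg (Real.exp_pos _).le,
        Real.norm_of_nonneg (Real.exp_pos _).le]
    · simp only [α, if_neg hp, norm_zero]
      positivity
  · by_cases hp : p.1 = j
    · simp only [β, if_pos hp]
      rw [norm_mul, Complex.norm_exp_ofReal_mul_I, mul_one, Complex.norm_real, norm_mul,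
        Real.norm_of_nonneg (Real.exp_pos _).le,
        Real.norm_of_nonneg (Real.exp_pos _).le, one_mul]
    · simp only [β, if_neg hp, norm_zero]
      positivity

/-- The heat part becomes nuclear when its exponential weights increase with time. -/
theorem isNuclearKernel_heat {τ s : Fin m → ℝ} (hτ : StrictMono τ) {c : Fin m → ℝ}
    (hc : StrictMono c) (A : Fin m → ℝ) :
    IsNuclearKernel (spaceMeasure m) fun p q =>
      if s p.1 < p.2 ∧ s q.1 < q.2 then
        ((Real.exp (A p.1 + c p.1 * p.2) * heatTerm (τ p.1) p.2 (τ q.1) q.2 *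
          Real.exp (-(A q.1 + c q.1 * q.2)) : ℝ) : ℂ) else 0 := by
  have key := IsNuclearKernel.sum (μ := spaceMeasure m)
    (Finset.univ.filter fun e : Fin m × Fin m => e.1 < e.2)
    (k := fun e p q => if p.1 = e.1 ∧ q.1 = e.2 then
        if s p.1 < p.2 ∧ s q.1 < q.2 then
          ((Real.exp (A p.1 + c p.1 * p.2) * heatTerm (τ p.1) p.2 (τ q.1) q.2 *
            Real.exp (-(A q.1 + c q.1 * q.2)) : ℝ) : ℂ) else 0
      else 0) fun e he => by
        have he : e.1 < e.2 := by simpa using he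
        exact isNuclearKernel_heat_pair e.1 e.2 (hτ he) (hc he)
  convert key using 3 with p q
  -- Only the block of the pair `(p.1, q.1)` survives, and for `p.1 ≥ q.1` the heat term is zero.
  rw [Finset.sum_filter, Finset.sum_eq_single (p.1, q.1)]
  · by_cases h : p.1 < q.1
    · simp [h]
    · have : ¬ τ p.1 < τ q.1 := fun h' => h (hτ.lt_iff_lt.1 h')
      simp [h, heatTerm, this]
  · intro e _ he
    have : ¬ (p.1 = e.1 ∧ q.1 = e.2) := fun h' => he (Prod.ext h'.1.symm h'.2.symm)
    simp [this]
  · simp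

end CutKernels
end AiryTransition

namespace AiryTransition

/-! ### The kernel in Airy form -/

section AiryForm

variable {m : ℕ}

theorem exists_forall_le (f : Fin m → ℝ) : ∃ N : ℝ, ∀ i, f i ≤ N :=
  ⟨∑ i, |f i|, fun i => (le_abs_self _).trans
    (Finset.single_le_sum (f := fun i => |f i|) (fun _ _ => abs_nonneg _) (Finset.mem_univ i))⟩

theorem memLp_exp_neg_Ioi :
    MemLp (fun l : ℝ => Real.exp (-l)) 2 (volume.restrict (Set.Ioi 0)) := by
  rw [memLp_two_iff_integrable_sq (Continuous.aestronglyMeasurable (by fun_prop))]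
  refine (exp_neg_integrableOn_Ioi 0 (b := 2) (by norm_num)).congr
    (Eventually.of_forall fun x => ?_)
  simp only
  rw [← Real.exp_nat_mul]
  congr 1; push_cast; ring

/-- The weighted Airy factors `e^{Bx + Eλ} Ai(ŝ + ελ)`. -/
noncomputable def airyFactor (τ B E : Fin m → ℝ) (ε : ℝ) (p : Fin m × ℝ) (l : ℝ) : ℂ :=
  (Real.exp (B p.1 * p.2 + E p.1 * l) : ℂ) * airyAi ((sHat (τ p.1) p.2 + ε * l : ℝ))

theorem measurable_airyFactor (τ B E : Fin m → ℝ) (ε : ℝ) :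
    Measurable (Function.uncurry (airyFactor τ B E ε)) := by
  have h1 : ∀ f : Fin m → ℝ, Measurable fun z : (Fin m × ℝ) × ℝ => f z.1.1 := fun f =>
    (measurable_of_finite f).comp (measurable_fst.comp measurable_fst)
  have hx : Measurable fun z : (Fin m × ℝ) × ℝ => z.1.2 := measurable_snd.comp measurable_fst
  refine Measurable.mul ?_ (measurable_airyAi.comp ?_)
  · exact Complex.measurable_ofReal.comp
      (Real.measurable_exp.comp (((h1 B).mul hx).add ((h1 E).mul measurable_snd)))
  · exact (hx.add (h1 fun i => max 0 (τ i) ^ 2)).add (measurable_snd.const_mul ε)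

/-- A rate `δ` for the Airy bound that exceeds `B` by one gives decay in `x` above the cut. For `ε =
1` it also beats `E`; for `ε = -1` the Airy bound grows like `e^{δl}`, and `E` itself has to be
negative enough. -/
theorem exists_norm_airyFactor_le (τ s B E : Fin m → ℝ) {ε δ : ℝ} (hδ : 0 < δ)
    (hB : ∀ i, B i + 1 ≤ δ) (hE : ∀ i, E i + 1 ≤ ε * δ) :
    ∃ C : Fin m → ℝ, ∀ᵐ l ∂(volume.restrict (Set.Ioi (0 : ℝ))), ∀ p : Fin m × ℝ, s p.1 < p.2 →
      ‖airyFactor τ B E ε p l‖ ≤ C p.1 * Real.exp (-1 * p.2) * Real.exp (-l) := by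
  obtain ⟨C, hC0, hC⟩ := exists_norm_airyAi_le hδ
  refine ⟨fun i => C * Real.exp (-δ * max 0 (τ i) ^ 2 + (B i - δ + 1) * s i),
    (ae_restrict_iff' measurableSet_Ioi).2 (Eventually.of_forall fun l hl p hp => ?_)⟩
  have hl : 0 < l := hl
  rw [airyFactor, norm_mul, Complex.norm_real, Real.norm_of_nonneg (Real.exp_pos _).le]
  calc _ ≤ Real.exp (B p.1 * p.2 + E p.1 * l) *
        (C * Real.exp (-δ * (sHat (τ p.1) p.2 + ε * l))) := by gcongr; exact hC _
    _ = C * Real.exp (B p.1 * p.2 + E p.1 * l + -δ * (sHat (τ p.1) p.2 + ε * l)) := by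
        rw [Real.exp_add (B p.1 * p.2 + E p.1 * l)]; ring
    _ ≤ C * Real.exp (-δ * max 0 (τ p.1) ^ 2 + (B p.1 - δ + 1) * s p.1 + -1 * p.2 + -l) := by
        refine mul_le_mul_of_nonneg_left (Real.exp_le_exp.2 ?_) hC0
        have h1 : (B p.1 - δ + 1) * p.2 ≤ (B p.1 - δ + 1) * s p.1 :=
          mul_le_mul_of_nonpos_left hp.le (by linarith [hB p.1])
        have h2 : (E p.1 + 1) * l ≤ ε * δ * l := by gcongr; exact hE p.1
        simp only [sHat]
        linarith
    _ = _ := by rw [Real.exp_add, Real.exp_add]; ring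

theorem isNuclearKernel_airyFactor (τ s : Fin m → ℝ) {B E B' E' : Fin m → ℝ} {ε δ ε' δ' : ℝ}
    (hδ : 0 < δ) (hδ' : 0 < δ') (hB : ∀ i, B i + 1 ≤ δ) (hE : ∀ i, E i + 1 ≤ ε * δ)
    (hB' : ∀ i, B' i + 1 ≤ δ') (hE' : ∀ i, E' i + 1 ≤ ε' * δ') :
    IsNuclearKernel (spaceMeasure m) fun p q =>
      if s p.1 < p.2 ∧ s q.1 < q.2 then
        ∫ l in Set.Ioi (0 : ℝ), airyFactor τ B E ε p l * airyFactor τ B' E' ε' q l else 0 := by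
  obtain ⟨C, hC⟩ := exists_norm_airyFactor_le τ s B E hδ hB hE
  obtain ⟨C', hC'⟩ := exists_norm_airyFactor_le τ s B' E' hδ' hB' hE'
  exact isNuclearKernel_cut one_pos one_pos memLp_exp_neg_Ioi memLp_exp_neg_Ioi
    (measurable_airyFactor ..) (measurable_airyFactor ..) hC hC'

theorem isNuclearKernel_airyK2 (τ s D : Fin m → ℝ) :
    IsNuclearKernel (spaceMeasure m) fun p q =>
      if s p.1 < p.2 ∧ s q.1 < q.2 then
        (Real.exp (D p.1 * p.2) : ℂ) * airyK2 (τ p.1) p.2 (τ q.1) q.2 /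
          (Real.exp (D q.1 * q.2) : ℂ) else 0 := by
  obtain ⟨N, hN⟩ := exists_forall_le fun i => |D i| + |τ i| + 1
  have hδ : 0 < max N 1 := lt_max_of_lt_right one_pos
  have hle : ∀ i, |D i| + |τ i| + 1 ≤ max N 1 := fun i => (hN i).trans (le_max_left _ _)
  have key := isNuclearKernel_airyFactor τ s (B := D) (E := fun i => -τ i) (B' := fun i => -D i)
    (E' := τ) (ε := 1) (ε' := 1) hδ hδ
    (fun i => by linarith [hle i, le_abs_self (D i), abs_nonneg (τ i)])
    (fun i => by linarith [hle i, neg_le_abs (τ i), abs_nonneg (D i)])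
    (fun i => by linarith [hle i, neg_le_abs (D i), abs_nonneg (τ i)])
    (fun i => by linarith [hle i, le_abs_self (τ i), abs_nonneg (D i)])
  convert key using 4 with p q
  rw [airyK2, div_eq_mul_inv, mul_comm, ← mul_assoc, ← integral_const_mul]
  refine integral_congr_ae (Eventually.of_forall fun l => ?_)
  have h : ((Real.exp (D q.1 * q.2) : ℂ))⁻¹ * (Real.exp (D p.1 * p.2) : ℂ) *
      (Real.exp (l * (τ q.1 - τ p.1)) : ℂ) =
      (Real.exp (D p.1 * p.2 + -τ p.1 * l) : ℂ) * (Real.exp (-D q.1 * q.2 + τ q.1 * l) : ℂ) := by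
    simp only [← Complex.ofReal_inv, ← Real.exp_neg, ← Complex.ofReal_mul, ← Real.exp_add]
    congr 2; ring
  simp only [airyFactor, one_mul]
  linear_combination airyAi ((sHat (τ q.1) q.2 + l : ℝ)) * airyAi ((sHat (τ p.1) p.2 + l : ℝ)) * h

theorem isNuclearKernel_airyK1 (τ s D : Fin m → ℝ) :
    IsNuclearKernel (spaceMeasure m) fun p q =>
      if s p.1 < p.2 ∧ s q.1 < q.2 then
        (Real.exp (D p.1 * p.2) : ℂ) * airyK1 (τ p.1) p.2 (τ q.1) q.2 /
          (Real.exp (D q.1 * q.2) : ℂ) else 0 := by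
  obtain ⟨N, hN⟩ := exists_forall_le fun i => |D i| + |τ i| + 1
  set δ := max N 1
  have hδ : 0 < δ := lt_max_of_lt_right one_pos
  have hle : ∀ i, |D i| + |τ i| + 1 ≤ δ := fun i => (hN i).trans (le_max_left _ _)
  -- The bound for `Ai (ŝ₁ - λ)` grows like `e^{δλ}`. A factor `e^{-2δλ}` is given to it and
  -- compensated by `e^{2δλ}` in the other factor, whose Airy function is bounded at rate `3δ`.
  have key := isNuclearKernel_airyFactor τ s (B := D) (E := fun i => τ i - 2 * δ)
    (B' := fun i => -D i) (E' := fun i => τ i + 2 * δ) (ε := -1) (ε' := 1) (δ' := 3 * δ) hδ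
    (by positivity)
    (fun i => by linarith [hle i, le_abs_self (D i), abs_nonneg (τ i)])
    (fun i => by linarith [hle i, le_abs_self (τ i), abs_nonneg (D i)])
    (fun i => by linarith [hle i, neg_le_abs (D i), abs_nonneg (τ i)])
    (fun i => by linarith [hle i, le_abs_self (τ i), abs_nonneg (D i)])
  convert key using 4 with p q
  rw [airyK1, div_eq_mul_inv, mul_comm, ← mul_assoc, ← integral_const_mul]
  refine integral_congr_ae (Eventually.of_forall fun l => ?_)
  have h : ((Real.exp (D q.1 * q.2) : ℂ))⁻¹ * (Real.exp (D p.1 * p.2) : ℂ) *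
      (Real.exp (l * (τ q.1 + τ p.1)) : ℂ) =
      (Real.exp (D p.1 * p.2 + (τ p.1 - 2 * δ) * l) : ℂ) *
        (Real.exp (-D q.1 * q.2 + (τ q.1 + 2 * δ) * l) : ℂ) := by
    simp only [← Complex.ofReal_inv, ← Real.exp_neg, ← Complex.ofReal_mul, ← Real.exp_add]
    congr 2; ring
  simp only [airyFactor, one_mul, neg_one_mul, ← sub_eq_add_neg]
  linear_combination airyAi ((sHat (τ q.1) q.2 + l : ℝ)) * airyAi ((sHat (τ p.1) p.2 - l : ℝ)) * h

/-- Exponential weights that make a kernel nuclear give a well-defined Fredholm determinant. -/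
theorem fredholmDetWellDefined_of_exp_weight {k : Fin m × ℝ → Fin m × ℝ → ℂ} (D : Fin m → ℝ)
    (h : IsNuclearKernel (spaceMeasure m) fun p q =>
      (Real.exp (D p.1 * p.2) : ℂ) * k p q / (Real.exp (D q.1 * q.2) : ℂ)) :
    FredholmDetWellDefined (spaceMeasure m) k := by
  obtain ⟨T, hT, hT'⟩ := h
  refine fredholmDetWellDefined_of_exists ⟨T, ⟨_, ⟨fun p => Real.exp (D p.1 * p.2), ?_,
    fun p => (Real.exp_pos _).ne', fun p q => rfl⟩, hT⟩, hT'⟩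
  exact Real.measurable_exp.comp
    (((measurable_of_finite D).comp measurable_fst).mul measurable_snd)

theorem fredholmDetWellDefined_airyKernel {τ : Fin m → ℝ} (s : Fin m → ℝ) (hτ : StrictMono τ)
    (σ : ℝ) : FredholmDetWellDefined (spaceMeasure m) (cutKernel τ s (airyKernel σ)) := by
  -- The term `σ τ` cancels the `x`-dependent exponential in the prefactor of `airyK0`; the index
  -- `i` is the strictly increasing rate that the heat part needs.
  let D : Fin m → ℝ := fun i => σ * τ i + (i : ℕ)
  refine fredholmDetWellDefined_of_exp_weight D ?_
  have hc : StrictMono fun i : Fin m => ((i : ℕ) : ℝ) := fun i j h =>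
    Nat.cast_lt.2 (Fin.lt_def.1 h)
  have key := ((isNuclearKernel_heat (s := s) hτ hc
    fun i => -σ * (2 / 3 * τ i ^ 3 - τ i * min 0 (τ i) ^ 2)).add
    (isNuclearKernel_airyK1 τ s D)).add (isNuclearKernel_airyK2 τ s D)
  convert key using 3 with p q
  by_cases h : s p.1 < p.2 ∧ s q.1 < q.2
  · simp only [cutKernel, airyKernel, airyK0, if_pos h]
    rw [mul_add, mul_add, add_div, add_div]
    congr 2
    rw [← Complex.ofReal_mul, ← Complex.ofReal_div]
    congr 1
    rw [div_eq_mul_inv, ← Real.exp_neg]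
    have e : Real.exp (D p.1 * p.2) *
        Real.exp (σ * ((2 / 3 * τ q.1 ^ 3 + τ q.1 * sTilde (τ q.1) q.2) -
          (2 / 3 * τ p.1 ^ 3 + τ p.1 * sTilde (τ p.1) p.2))) * Real.exp (-(D q.1 * q.2)) =
        Real.exp (-σ * (2 / 3 * τ p.1 ^ 3 - τ p.1 * min 0 (τ p.1) ^ 2) + (p.1 : ℕ) * p.2) *
        Real.exp (-(-σ * (2 / 3 * τ q.1 ^ 3 - τ q.1 * min 0 (τ q.1) ^ 2) + (q.1 : ℕ) * q.2)) := by
      simp only [← Real.exp_add]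
      congr 1
      simp only [sTilde, D]
      ring
    linear_combination heatTerm (τ p.1) p.2 (τ q.1) q.2 * e
  · simp [cutKernel, h]

end AiryForm
end AiryTransition

namespace AiryTransition

/-! ### Parametrised broken lines -/

section BrokenLine

/-- The broken line with apex `a` and directions `e^{±iφ}`, run through upwards. -/
noncomputable def brokenLine (a φ r : ℝ) : ℂ :=
  ⟨a + |r| * Real.cos φ, r * Real.sin φ⟩

/-- The derivative of `brokenLine`. -/
noncomputable def brokenLineDeriv (φ r : ℝ) : ℂ :=
  if 0 < r then Complex.exp (φ * Complex.I) else -Complex.exp (-(φ * Complex.I))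

theorem brokenLine_of_nonneg (a φ : ℝ) {r : ℝ} (hr : 0 ≤ r) :
    brokenLine a φ r = a + r * Complex.exp (φ * Complex.I) := by
  apply Complex.ext
  · simp [brokenLine, abs_of_nonneg hr, Complex.exp_ofReal_mul_I_re]
  · simp [brokenLine, Complex.exp_ofReal_mul_I_im]

theorem brokenLine_neg (a φ : ℝ) {r : ℝ} (hr : 0 ≤ r) :
    brokenLine a φ (-r) = a + r * Complex.exp (-(φ * Complex.I)) := by
  rw [conj_exp_mul_I]
  apply Complex.ext
  · simp [brokenLine, abs_of_nonneg hr, Complex.exp_ofReal_mul_I_re]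
  · simp [brokenLine, Complex.exp_ofReal_mul_I_im]

theorem continuous_brokenLine (a φ : ℝ) : Continuous (brokenLine a φ) := by
  have : brokenLine a φ = fun r => ((a + |r| * Real.cos φ : ℝ) : ℂ) +
      ((r * Real.sin φ : ℝ) : ℂ) * Complex.I := by
    ext r
    rw [brokenLine, Complex.mk_eq_add_mul_I]
  rw [this]
  fun_prop

theorem measurable_brokenLineDeriv (φ : ℝ) : Measurable (brokenLineDeriv φ) :=
  Measurable.ite measurableSet_Ioi measurable_const measurable_const

theorem norm_brokenLineDeriv (φ r : ℝ) : ‖brokenLineDeriv φ r‖ = 1 := by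
  unfold brokenLineDeriv
  split_ifs
  · exact Complex.norm_exp_ofReal_mul_I φ
  · rw [norm_neg, conj_exp_mul_I, RCLike.norm_conj]
    exact Complex.norm_exp_ofReal_mul_I φ

theorem wedgeIntegral_eq_integral {a φ : ℝ} {f : ℂ → ℂ}
    (hf : Integrable fun r : ℝ => f (brokenLine a φ r) * brokenLineDeriv φ r) :
    wedgeIntegral a φ f = ∫ r : ℝ, f (brokenLine a φ r) * brokenLineDeriv φ r := by
  have h1 : Set.EqOn (fun r : ℝ => f (brokenLine a φ r) * brokenLineDeriv φ r)
      (fun r : ℝ => f (a + r * Complex.exp (φ * Complex.I)) * Complex.exp (φ * Complex.I))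
      (Set.Ioi 0) := fun r hr => by
    have hr : 0 < r := hr
    simp only [brokenLine_of_nonneg a φ hr.le, brokenLineDeriv, if_pos hr]
  have h2 : Set.EqOn (fun r : ℝ => f (brokenLine a φ (-r)) * brokenLineDeriv φ (-r))
      (fun r : ℝ => -(f (a + r * Complex.exp (-(φ * Complex.I))) *
        Complex.exp (-(φ * Complex.I)))) (Set.Ioi 0) := fun r hr => by
    have hr : 0 < r := hr
    have : ¬ 0 < -r := by linarith
    simp only [brokenLine_neg a φ hr.le, brokenLineDeriv, if_neg this, mul_neg]
  have i1 := hf.integrableOn.congr_fun h1 measurableSet_Ioi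
  have i2 := (hf.comp_neg.integrableOn (s := Set.Ioi 0)).congr_fun h2 measurableSet_Ioi
  rw [← intervalIntegral.integral_Iic_add_Ioi (b := 0) hf.integrableOn hf.integrableOn,
    ← neg_zero, ← integral_comp_neg_Ioi, neg_zero, setIntegral_congr_fun measurableSet_Ioi h1,
    setIntegral_congr_fun measurableSet_Ioi h2, ← integral_add i2 i1]
  refine integral_congr_ae (Eventually.of_forall fun r => ?_)
  simp only
  ring

theorem integrable_exp_neg_sq : Integrable fun r : ℝ => Real.exp (-r ^ 2) := by
  simpa using integrable_exp_neg_mul_sq one_pos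

/-- Iterated integrals along two broken lines as a double integral. -/
theorem wedgeIntegral_wedgeIntegral {a φ b ψ K : ℝ} {F : ℂ → ℂ → ℂ}
    (hm : Measurable fun t : ℝ × ℝ => F (brokenLine a φ t.1) (brokenLine b ψ t.2))
    (hF : ∀ r r' : ℝ, ‖F (brokenLine a φ r) (brokenLine b ψ r')‖ ≤
      K * (Real.exp (-r ^ 2) * Real.exp (-r' ^ 2))) :
    wedgeIntegral a φ (fun w => wedgeIntegral b ψ (F w)) =
      ∫ t : ℝ × ℝ, F (brokenLine a φ t.1) (brokenLine b ψ t.2) *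
        (brokenLineDeriv φ t.1 * brokenLineDeriv ψ t.2) := by
  have hint : Integrable (fun t : ℝ × ℝ => F (brokenLine a φ t.1) (brokenLine b ψ t.2) *
      (brokenLineDeriv φ t.1 * brokenLineDeriv ψ t.2)) (volume.prod volume) := by
    refine Integrable.mono' ((integrable_exp_neg_sq.mul_prod integrable_exp_neg_sq).const_mul K)
      (hm.mul (((measurable_brokenLineDeriv φ).comp measurable_fst).mul
        ((measurable_brokenLineDeriv ψ).comp measurable_snd))).aestronglyMeasurable
      (Eventually.of_forall fun t => ?_)
    rw [norm_mul, norm_mul, norm_brokenLineDeriv, norm_brokenLineDeriv, one_mul, mul_one]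
    exact hF t.1 t.2
  have hin : ∀ r : ℝ, wedgeIntegral b ψ (F (brokenLine a φ r)) =
      ∫ r' : ℝ, F (brokenLine a φ r) (brokenLine b ψ r') * brokenLineDeriv ψ r' := by
    intro r
    refine wedgeIntegral_eq_integral ?_
    refine Integrable.mono' ((integrable_exp_neg_sq.const_mul (K * Real.exp (-r ^ 2))))
      ((hm.comp measurable_prodMk_left).mul (measurable_brokenLineDeriv ψ)).aestronglyMeasurable
      (Eventually.of_forall fun r' => ?_)
    rw [norm_mul, norm_brokenLineDeriv, mul_one, mul_assoc]
    exact hF r r'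
  have hout : ∀ r : ℝ, wedgeIntegral b ψ (F (brokenLine a φ r)) * brokenLineDeriv φ r =
      ∫ r' : ℝ, F (brokenLine a φ r) (brokenLine b ψ r') *
        (brokenLineDeriv φ r * brokenLineDeriv ψ r') := by
    intro r
    rw [hin, ← integral_mul_const]
    refine integral_congr_ae (Eventually.of_forall fun r' => ?_)
    simp only
    ring
  have h := hint.integral_prod_left
  rw [wedgeIntegral_eq_integral]
  · simp_rw [hout]
    exact (integral_prod _ hint).symm
  · simp_rw [hout]
    exact h

theorem brokenLine_re (a φ r : ℝ) : (brokenLine a φ r).re = a + |r| * Real.cos φ := rfl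

theorem brokenLine_im (a φ r : ℝ) : (brokenLine a φ r).im = r * Real.sin φ := rfl

/-- The two directions `e^{±iφ}` are conjugate, so their cubes share the real part `cos 3φ`, which
governs decay on both arms. -/
theorem exists_brokenLine_eq (a φ r : ℝ) :
    ∃ u : ℂ, ‖u‖ = 1 ∧ (u ^ 3).re = Real.cos (3 * φ) ∧ brokenLine a φ r = a + |r| * u := by
  have h3 : (Complex.exp (φ * Complex.I) ^ 3).re = Real.cos (3 * φ) := by
    rw [← Complex.exp_nat_mul, ← Complex.exp_ofReal_mul_I_re]
    congr 2; push_cast; ring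
  rcases le_total 0 r with hr | hr
  · exact ⟨_, Complex.norm_exp_ofReal_mul_I φ, h3, by
      rw [brokenLine_of_nonneg a φ hr, abs_of_nonneg hr]⟩
  · refine ⟨Complex.exp (-(φ * Complex.I)), ?_, ?_, ?_⟩
    · rw [conj_exp_mul_I, RCLike.norm_conj]
      exact Complex.norm_exp_ofReal_mul_I φ
    · rw [conj_exp_mul_I, ← map_pow, Complex.conj_re, h3]
    · have := brokenLine_neg a φ (r := -r) (by linarith)
      rw [neg_neg] at this
      rw [this, abs_of_nonpos hr]

theorem norm_brokenLine_le (a φ r : ℝ) : ‖brokenLine a φ r‖ ≤ |a| + |r| := by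
  obtain ⟨u, hu, -, h⟩ := exists_brokenLine_eq a φ r
  rw [h]
  refine (norm_add_le _ _).trans ?_
  simp [hu]

/-- Only the pure cubic term depends on the direction in an essential way; the coefficients of the
lower powers of `r` are each at most `(|a| + |τ| + 1)³`. -/
theorem abs_re_cubic_sub_le (a τ r : ℝ) (hr : 0 ≤ r) {u : ℂ} (hu : ‖u‖ = 1) :
    |((a + r * u) ^ 3 / 3 + τ * (a + r * u) ^ 2 : ℂ).re - r ^ 3 * (u ^ 3).re / 3| ≤
      (|a| + |τ| + 1) ^ 3 * (r ^ 2 + r + 1) := by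
  have h1 : ((a + r * u) ^ 3 / 3 + τ * (a + r * u) ^ 2 : ℂ).re - r ^ 3 * (u ^ 3).re / 3 =
      ((a ^ 3 / 3 + τ * a ^ 2 : ℝ) + (r * (a ^ 2 + 2 * τ * a) : ℝ) * u +
        (r ^ 2 * (a + τ) : ℝ) * u ^ 2 : ℂ).re := by
    have e : ((a + r * u) ^ 3 / 3 + τ * (a + r * u) ^ 2 : ℂ) = ((r ^ 3 / 3 : ℝ) : ℂ) * u ^ 3 +
      ((a ^ 3 / 3 + τ * a ^ 2 : ℝ) + (r * (a ^ 2 + 2 * τ * a) : ℝ) * u +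
        (r ^ 2 * (a + τ) : ℝ) * u ^ 2 : ℂ) := by push_cast; ring
    rw [e, Complex.add_re, Complex.re_ofReal_mul]
    ring
  rw [h1]
  refine (Complex.abs_re_le_norm _).trans ((norm_add₃_le).trans ?_)
  rw [norm_mul, norm_mul, norm_pow, hu, Complex.norm_real, Complex.norm_real, Complex.norm_real,
    Real.norm_eq_abs, Real.norm_eq_abs, Real.norm_eq_abs, abs_mul, abs_mul, abs_of_nonneg hr,
    abs_of_nonneg (sq_nonneg r), one_pow, mul_one, mul_one]
  have hA := abs_nonneg a
  have hT := abs_nonneg τ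
  have b1 : |a ^ 3 / 3 + τ * a ^ 2| ≤ (|a| + |τ| + 1) ^ 3 := by
    refine (abs_add_le _ _).trans ?_
    rw [abs_div, abs_mul, abs_pow, abs_pow, abs_of_pos (by norm_num : (0 : ℝ) < 3)]
    nlinarith [mul_nonneg hA hT, pow_nonneg hA 3, pow_nonneg hT 3, pow_nonneg hA 2,
      pow_nonneg hT 2, mul_nonneg (pow_nonneg hA 2) hT, mul_nonneg hA (pow_nonneg hT 2)]
  have b2 : |a ^ 2 + 2 * τ * a| ≤ (|a| + |τ| + 1) ^ 3 := by
    refine (abs_add_le _ _).trans ?_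
    rw [abs_mul, abs_mul, abs_pow, abs_of_pos (by norm_num : (0 : ℝ) < 2)]
    nlinarith [mul_nonneg hA hT, pow_nonneg hA 3, pow_nonneg hT 3, pow_nonneg hA 2,
      pow_nonneg hT 2, mul_nonneg (pow_nonneg hA 2) hT, mul_nonneg hA (pow_nonneg hT 2)]
  have b3 : |a + τ| ≤ (|a| + |τ| + 1) ^ 3 := by
    refine (abs_add_le _ _).trans ?_
    nlinarith [mul_nonneg hA hT, pow_nonneg hA 3, pow_nonneg hT 3, pow_nonneg hA 2,
      pow_nonneg hT 2, mul_nonneg (pow_nonneg hA 2) hT, mul_nonneg hA (pow_nonneg hT 2)]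
  nlinarith [mul_le_mul_of_nonneg_left b2 hr, mul_le_mul_of_nonneg_left b3 (sq_nonneg r)]

end BrokenLine
end AiryTransition

namespace AiryTransition

/-! ### The kernel in contour form -/

section ContourForm

variable {m : ℕ}

/-- The exponential factor `exp (η (w³/3 + τ w² - s̃ w + c x))` at the point `w` of a broken line
with parameter `r`. -/
noncomputable def contourFactor (τ c : Fin m → ℝ) (η a φ : ℝ) (p : Fin m × ℝ) (r : ℝ) : ℂ :=
  Complex.exp (η * (brokenLine a φ r ^ 3 / 3 + τ p.1 * brokenLine a φ r ^ 2 -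
    sTilde (τ p.1) p.2 * brokenLine a φ r + c p.1 * p.2))

theorem measurable_contourFactor (τ c : Fin m → ℝ) (η a φ : ℝ) :
    Measurable (Function.uncurry (contourFactor τ c η a φ)) := by
  have h1 : ∀ f : Fin m → ℝ, Measurable fun z : (Fin m × ℝ) × ℝ => ((f z.1.1 : ℝ) : ℂ) := fun f =>
    Complex.measurable_ofReal.comp
      ((measurable_of_finite f).comp (measurable_fst.comp measurable_fst))
  have hx : Measurable fun z : (Fin m × ℝ) × ℝ => ((z.1.2 : ℝ) : ℂ) :=
    Complex.measurable_ofReal.comp (measurable_snd.comp measurable_fst)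
  have hw : Measurable fun z : (Fin m × ℝ) × ℝ => brokenLine a φ z.2 :=
    (continuous_brokenLine a φ).measurable.comp measurable_snd
  have hs : Measurable fun z : (Fin m × ℝ) × ℝ => ((sTilde (τ z.1.1) z.1.2 : ℝ) : ℂ) := by
    simp only [sTilde, Complex.ofReal_sub]
    exact hx.sub (h1 fun i => min 0 (τ i) ^ 2)
  exact Complex.measurable_exp.comp ((((((hw.pow_const 3).div_const 3).add
    ((h1 τ).mul (hw.pow_const 2))).sub (hs.mul hw)).add ((h1 c).mul hx)).const_mul _)

theorem measurable_contourFactor_apply (τ c : Fin m → ℝ) (η a φ : ℝ) (p : Fin m × ℝ) :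
    Measurable (contourFactor τ c η a φ p) :=
  (measurable_contourFactor τ c η a φ).of_uncurry_left

/-- The cubic term decays along the path and absorbs all lower powers of `r`, including the cross
terms with `s` and the extra `3r²`. The terms linear in `x` give `exp (-κ x)`, because `c` lies at
least `κ` to the appropriate side of the path and `x > s`. -/
theorem exists_norm_contourFactor_le (τ s c : Fin m → ℝ) {η a φ κ : ℝ} (hη : |η| = 1)
    (hφ : η * Real.cos (3 * φ) < 0) (hκ : ∀ i r, η * (c i - (brokenLine a φ r).re) ≤ -κ) :
    ∃ C : Fin m → ℝ, (∀ i, 0 ≤ C i) ∧ ∀ r p, s p.1 < p.2 →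
      ‖contourFactor τ c η a φ p r‖ ≤
        C p.1 * Real.exp (-κ * p.2) * Real.exp (-(3 * r ^ 2)) := by
  have hκ3 : 0 < -(η * Real.cos (3 * φ)) / 3 := by linarith
  let B₀ : Fin m → ℝ := fun i => (|a| + |τ i| + 1) ^ 3
  let M : Fin m → ℝ := fun i => min 0 (τ i) ^ 2
  choose C hC using fun i => exists_cubic_le hκ3 (B₀ i + |s i| + |M i| + 3)
  refine ⟨fun i => Real.exp (C i + B₀ i + (|c i| + |a| + |κ|) * |s i| + |M i| * |a|),
    fun i => (Real.exp_pos _).le, fun r p hp => ?_⟩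
  obtain ⟨i, x⟩ := p
  simp only at hp ⊢
  rw [contourFactor, Complex.norm_exp, ← Real.exp_add, ← Real.exp_add]
  refine Real.exp_le_exp.2 ?_
  simp only
  set w := brokenLine a φ r with hw
  obtain ⟨u, hu, hu3, hwu⟩ := exists_brokenLine_eq a φ r
  rw [Complex.re_ofReal_mul, Complex.add_re, Complex.sub_re, Complex.re_ofReal_mul,
    ← Complex.ofReal_mul, Complex.ofReal_re]
  set R3 := (w ^ 3 / 3 + τ i * w ^ 2 : ℂ).re
  have hR := abs_nonneg r
  have hR3 : |R3 - |r| ^ 3 * Real.cos (3 * φ) / 3| ≤ B₀ i * (|r| ^ 2 + |r| + 1) := by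
    have := abs_re_cubic_sub_le a (τ i) |r| hR hu
    rwa [← hwu, hu3] at this
  have e1 : η * R3 ≤ η * Real.cos (3 * φ) / 3 * |r| ^ 3 + B₀ i * (|r| ^ 2 + |r| + 1) := by
    have : η * (R3 - |r| ^ 3 * Real.cos (3 * φ) / 3) ≤ B₀ i * (|r| ^ 2 + |r| + 1) := by
      refine (le_abs_self _).trans ?_
      rw [abs_mul, hη, one_mul]
      exact hR3
    linarith
  have hρ : |w.re| ≤ |a| + |r| := (Complex.abs_re_le_norm w).trans (norm_brokenLine_le a φ r)
  have hk := hκ i r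
  rw [← hw] at hk
  have e2 : η * (c i - w.re) * x ≤ -κ * x + (|c i| + |a| + |r| + |κ|) * |s i| := by
    have h1 : (η * (c i - w.re) + κ) * x ≤ (η * (c i - w.re) + κ) * s i :=
      mul_le_mul_of_nonpos_left hp.le (by linarith)
    have h2 : (η * (c i - w.re) + κ) * s i ≤ (|c i| + |a| + |r| + |κ|) * |s i| := by
      refine (le_abs_self _).trans ?_
      rw [abs_mul]
      gcongr
      refine (abs_add_le _ _).trans ?_
      rw [abs_mul, hη, one_mul]
      have := abs_sub (c i) w.re
      linarith
    linarith
  have e3 : η * (M i * w.re) ≤ |M i| * (|a| + |r|) := by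
    refine (le_abs_self _).trans ?_
    rw [abs_mul, hη, one_mul, abs_mul]
    gcongr
  have e4 := hC i |r| hR
  have e5 : η * (R3 - sTilde (τ i) x * w.re + c i * x) =
      η * R3 + η * (c i - w.re) * x + η * (M i * w.re) := by
    simp only [sTilde, M]; ring
  have e6 : r ^ 2 = |r| ^ 2 := (sq_abs r).symm
  rw [e5, e6]
  have e7 : 0 ≤ (|s i| + |M i|) * |r| ^ 2 := by positivity
  nlinarith

theorem norm_ge_of_re_im {v : ℂ} {d θ : ℝ} (h : d ≤ v.re * Real.sin θ + v.im * Real.cos θ) :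
    d ≤ ‖v‖ := by
  refine h.trans ?_
  have h1 : v.re * Real.sin θ + v.im * Real.cos θ =
      (v * (starRingEnd ℂ) (⟨Real.sin θ, Real.cos θ⟩ : ℂ)).re := by
    simp
  have h2 : ‖(⟨Real.sin θ, Real.cos θ⟩ : ℂ)‖ = 1 := by
    rw [← sq_eq_sq₀ (norm_nonneg _) zero_le_one, ← Complex.normSq_eq_norm_sq, Complex.normSq_mk]
    nlinarith [Real.sin_sq_add_cos_sq θ]
  rw [h1]
  refine (Complex.re_le_norm _).trans ?_
  rw [norm_mul, RCLike.norm_conj, h2, mul_one]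

variable {a b φp φm : ℝ}

/-- Project `z + w` onto the normal of the arm containing `z`. That arm contributes the constant `b
sin φ₋`, the apex `a` contributes `a sin φ₋`, and moving along `w` adds a nonnegative multiple of
`sin (φ₋ ∓ φ₊)`. -/
theorem le_norm_brokenLine_add (hp : 0 < φp) (hm : φp < φm)
    (hpm : φm < Real.pi - φp) (r r' : ℝ) :
    (a + b) * Real.sin φm ≤ ‖brokenLine b φm r' + brokenLine a φp r‖ := by
  have h1 : 0 ≤ Real.sin (φm - φp) :=
    Real.sin_nonneg_of_nonneg_of_le_pi (by linarith) (by linarith)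
  have h2 : 0 ≤ Real.sin (φm + φp) :=
    Real.sin_nonneg_of_nonneg_of_le_pi (by linarith) (by linarith)
  rw [Real.sin_sub] at h1
  rw [Real.sin_add] at h2
  rcases le_total 0 r' with hr' | hr'
  · refine norm_ge_of_re_im (θ := Real.pi - φm) ?_
    rw [Real.sin_pi_sub, Real.cos_pi_sub, Complex.add_re, Complex.add_im, brokenLine_re,
      brokenLine_re, brokenLine_im, brokenLine_im, abs_of_nonneg hr']
    rcases le_total 0 r with hr | hr
    · rw [abs_of_nonneg hr]; nlinarith [mul_nonneg hr h1]
    · rw [abs_of_nonpos hr]; nlinarith [mul_nonneg (neg_nonneg.2 hr) h2]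
  · refine norm_ge_of_re_im (θ := φm) ?_
    rw [Complex.add_re, Complex.add_im, brokenLine_re,
      brokenLine_re, brokenLine_im, brokenLine_im, abs_of_nonpos hr']
    rcases le_total 0 r with hr | hr
    · rw [abs_of_nonneg hr]; nlinarith [mul_nonneg hr h2]
    · rw [abs_of_nonpos hr]; nlinarith [mul_nonneg (neg_nonneg.2 hr) h1]

theorem le_norm_brokenLine_sub (hp : 0 ≤ Real.cos φp) (hm : Real.cos φm ≤ 0) (r r' : ℝ) :
    a - b ≤ ‖brokenLine b φm r' - brokenLine a φp r‖ := by
  rw [norm_sub_rev]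
  refine le_trans ?_ (Complex.re_le_norm _)
  rw [Complex.sub_re, brokenLine_re, brokenLine_re]
  nlinarith [mul_nonneg (abs_nonneg r) hp, mul_nonneg (abs_nonneg r') (neg_nonneg.2 hm)]

/-- The rational factor of the contour integrand grows at most linearly in `w`. -/
theorem exists_norm_rational_le (hab : -a < b) (hba : b < a)
    (hp : φp ∈ Set.Ioo (Real.pi / 3) (Real.pi / 2))
    (hm : φm ∈ Set.Ioo (Real.pi / 2) (Real.pi - φp)) :
    ∃ K : ℝ, 0 ≤ K ∧ ∀ r r' : ℝ,
      ‖2 * brokenLine a φp r / ((brokenLine b φm r' - brokenLine a φp r) *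
        (brokenLine b φm r' + brokenLine a φp r))‖ ≤ K * Real.exp (r ^ 2) := by
  have hpi := Real.pi_pos
  obtain ⟨hp1, hp2⟩ := hp
  obtain ⟨hm1, hm2⟩ := hm
  have hsin : 0 < Real.sin φm := Real.sin_pos_of_pos_of_lt_pi (by linarith) (by linarith)
  have hcp : 0 ≤ Real.cos φp := Real.cos_nonneg_of_neg_pi_div_two_le_of_le (by linarith) hp2.le
  have hcm : Real.cos φm ≤ 0 := Real.cos_nonpos_of_pi_div_two_le_of_le hm1.le (by linarith)
  have hd : 0 < (a - b) * ((a + b) * Real.sin φm) :=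
    mul_pos (by linarith) (mul_pos (by linarith) hsin)
  refine ⟨2 * (|a| + 1) / ((a - b) * ((a + b) * Real.sin φm)), by positivity, fun r r' => ?_⟩
  rw [norm_div, norm_mul, norm_mul, Complex.norm_ofNat, div_mul_eq_mul_div]
  have h1 := norm_brokenLine_le a φp r
  have h2 : |a| + |r| ≤ (|a| + 1) * Real.exp (r ^ 2) := by
    have := Real.add_one_le_exp (r ^ 2)
    have h3 : |r| ≤ r ^ 2 + 1 := by rw [← sq_abs]; nlinarith [sq_nonneg (|r| - 1), abs_nonneg r]
    nlinarith [abs_nonneg a, sq_nonneg r]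
  have h4 := le_norm_brokenLine_sub (a := a) (b := b) hcp hcm r r'
  have h5 := le_norm_brokenLine_add (a := a) (b := b) (by linarith) (by linarith) hm2 r r'
  have h6 : 0 ≤ (a + b) * Real.sin φm := by
    have : 0 < a + b := by linarith
    positivity
  exact div_le_div₀ (by positivity) (by linarith) hd (mul_le_mul h4 h5 h6 (norm_nonneg _))

theorem norm_mul_mul_le_gaussian {x y z : ℂ} {A B K r r' : ℝ} (hA : 0 ≤ A) (hB : 0 ≤ B)
    (hK : 0 ≤ K) (hx : ‖x‖ ≤ A * Real.exp (-(3 * r' ^ 2))) (hy : ‖y‖ ≤ B * Real.exp (-(3 * r ^ 2)))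
    (hz : ‖z‖ ≤ K * Real.exp (r ^ 2)) :
    ‖x * y * z‖ ≤ A * B * K * (Real.exp (-r ^ 2) * Real.exp (-r' ^ 2)) := by
  rw [norm_mul, norm_mul]
  calc _ ≤ (A * Real.exp (-(3 * r' ^ 2))) * (B * Real.exp (-(3 * r ^ 2))) *
        (K * Real.exp (r ^ 2)) := by gcongr
    _ = A * B * K * Real.exp (-(3 * r' ^ 2) + -(3 * r ^ 2) + r ^ 2) := by
        rw [Real.exp_add, Real.exp_add]; ring
    _ ≤ _ := by
        rw [← Real.exp_add]
        refine mul_le_mul_of_nonneg_left (Real.exp_le_exp.2 ?_) (by positivity)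
        nlinarith [sq_nonneg r, sq_nonneg r']

set_option maxHeartbeats 1000000 in
theorem fredholmDetWellDefined_contourKernel {τ : Fin m → ℝ} (s : Fin m → ℝ) (hτ : StrictMono τ)
    (hab : -a < b) (hba : b < a) (hp : φp ∈ Set.Ioo (Real.pi / 3) (Real.pi / 2))
    (hm : φm ∈ Set.Ioo (Real.pi / 2) (Real.pi - φp)) :
    FredholmDetWellDefined (spaceMeasure m) (cutKernel τ s (contourKernel a b φp φm)) := by
  have hpi := Real.pi_pos
  obtain ⟨K, hK0, hK⟩ := exists_norm_rational_le hab hba hp hm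
  obtain ⟨hp1, hp2⟩ := hp
  obtain ⟨hm1, hm2⟩ := hm
  have hcp : 0 ≤ Real.cos φp := Real.cos_nonneg_of_neg_pi_div_two_le_of_le (by linarith) hp2.le
  have hcm : Real.cos φm ≤ 0 := Real.cos_nonpos_of_pi_div_two_le_of_le hm1.le (by linarith)
  have hcp3 : Real.cos (3 * φp) < 0 :=
    Real.cos_neg_of_pi_div_two_lt_of_lt (by linarith) (by linarith)
  have hcm3 : 0 < Real.cos (3 * φm) := by
    rw [← Real.cos_sub_two_pi]
    exact Real.cos_pos_of_mem_Ioo ⟨by linarith, by linarith⟩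
  -- Equally spaced rates `c`, decreasing in the index and at distance at least `κ` from both `a`
  -- and `b`.
  set κ := (a - b) / (m + 2) with hκdef
  have hκ : 0 < κ := div_pos (by linarith) (by positivity)
  have hκm : κ * (m + 2) = a - b := div_mul_cancel₀ _ (by positivity)
  let c : Fin m → ℝ := fun i => a - κ * ((i : ℕ) + 1)
  have hca : ∀ i, c i ≤ a - κ := fun i => by
    have : 0 ≤ κ * (i : ℕ) := by positivity
    simp only [c]; linarith
  have hcb : ∀ i, b + κ ≤ c i := fun i => by
    have h1 : ((i : ℕ) : ℝ) ≤ m := by exact_mod_cast i.2.le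
    have h2 := mul_le_mul_of_nonneg_left h1 hκ.le
    simp only [c]; linarith
  have hcm' : StrictMono fun i => -c i := fun i j hij => by
    have h1 : ((i : ℕ) : ℝ) < (j : ℕ) := Nat.cast_lt.2 (Fin.lt_def.1 hij)
    have h2 := mul_lt_mul_of_pos_left h1 hκ
    simp only [c]; linarith
  obtain ⟨C, hC0, hC⟩ := exists_norm_contourFactor_le τ s c (η := -1) (a := b) (φ := φm) (κ := κ)
    (by simp) (by linarith) fun i r => by
      rw [brokenLine_re]
      nlinarith [hcb i, mul_nonneg (abs_nonneg r) (neg_nonneg.2 hcm)]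
  obtain ⟨C', hC0', hC'⟩ := exists_norm_contourFactor_le τ s c (η := 1) (a := a) (φ := φp) (κ := κ)
    (by simp) (by linarith) fun i r => by
      rw [brokenLine_re]
      nlinarith [hca i, mul_nonneg (abs_nonneg r) hcp]
  set Q : ℝ → ℝ → ℂ := fun r r' => 2 * brokenLine a φp r /
    ((brokenLine b φm r' - brokenLine a φp r) * (brokenLine b φm r' + brokenLine a φp r)) with hQ
  have hQm : Measurable fun t : ℝ × ℝ => Q t.1 t.2 := by
    have hw : Measurable fun t : ℝ × ℝ => brokenLine a φp t.1 :=
      (continuous_brokenLine a φp).measurable.comp measurable_fst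
    have hz : Measurable fun t : ℝ × ℝ => brokenLine b φm t.2 :=
      (continuous_brokenLine b φm).measurable.comp measurable_snd
    exact (hw.const_mul 2).div ((hz.sub hw).mul (hz.add hw))
  set k₀ : ℂ := -((2 * Real.pi * Complex.I) ^ 2)⁻¹
  -- Both factors must be square integrable in the pair `t = (r, r')`, although the exponentials see
  -- only one parameter each. The reciprocal weights `exp (±(r'² - r²))` transfer Gaussian decay
  -- between them. The factor `Q` couples `z` and `w` and goes entirely into `β`.
  let α : Fin m × ℝ → ℝ × ℝ → ℂ := fun p t => contourFactor τ c (-1) b φm p t.2 *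
    (brokenLineDeriv φm t.2 * (Real.exp (t.2 ^ 2 - t.1 ^ 2) : ℂ))
  let β : Fin m × ℝ → ℝ × ℝ → ℂ := fun q t => contourFactor τ c 1 a φp q t.1 *
    (k₀ * Q t.1 t.2 * (brokenLineDeriv φp t.1 * (Real.exp (t.1 ^ 2 - t.2 ^ 2) : ℂ)))
  have hαm : Measurable (Function.uncurry α) := by
    refine ((measurable_contourFactor τ c (-1) b φm).comp
      (measurable_fst.prodMk (measurable_snd.comp measurable_snd))).mul
      (((measurable_brokenLineDeriv φm).comp (measurable_snd.comp measurable_snd)).mul ?_)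
    exact Continuous.measurable (by fun_prop)
  have hβm : Measurable (Function.uncurry β) := by
    refine ((measurable_contourFactor τ c 1 a φp).comp
      (measurable_fst.prodMk (measurable_fst.comp measurable_snd))).mul
      (((hQm.comp measurable_snd).const_mul k₀).mul
      (((measurable_brokenLineDeriv φp).comp (measurable_fst.comp measurable_snd)).mul ?_))
    exact Continuous.measurable (by fun_prop)
  have hg : MemLp (fun t : ℝ × ℝ => Real.exp (-t.1 ^ 2) * Real.exp (-t.2 ^ 2)) 2
      (volume.prod volume) := by
    have h := memLp_exp_neg_sq one_pos
    simp only [neg_one_mul] at h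
    rw [memLp_two_iff_integrable_sq (Continuous.aestronglyMeasurable (by fun_prop))]
    simpa only [mul_pow] using h.integrable_sq.mul_prod h.integrable_sq
  have hnuc := isNuclearKernel_cut (s := s) (C := C) (C' := fun i => ‖k₀‖ * K * C' i) hκ hκ hg hg
    hαm hβm (Eventually.of_forall fun t p h => ?_) (Eventually.of_forall fun t p h => ?_)
  · refine fredholmDetWellDefined_of_exp_weight (fun i => -c i) ?_
    convert (isNuclearKernel_heat (s := s) hτ hcm' fun _ => 0).add hnuc using 3 with p q
    by_cases hcut : s p.1 < p.2 ∧ s q.1 < q.2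
    · simp only [cutKernel, contourKernel, if_pos hcut]
      set F : ℂ → ℂ → ℂ := fun w z =>
        Complex.exp (w ^ 3 / 3 + τ q.1 * w ^ 2 - sTilde (τ q.1) q.2 * w) /
          Complex.exp (z ^ 3 / 3 + τ p.1 * z ^ 2 - sTilde (τ p.1) p.2 * z) *
          (2 * w / ((z - w) * (z + w))) with hF
      have hFe : ∀ r r', F (brokenLine a φp r) (brokenLine b φm r') =
          (Real.exp (c p.1 * p.2) : ℂ) * (Real.exp (-(c q.1 * q.2)) : ℂ) *
          (contourFactor τ c (-1) b φm p r' * contourFactor τ c 1 a φp q r * Q r r') := by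
        intro r r'
        simp only [hF, hQ, contourFactor]
        rw [← mul_assoc]
        congr 1
        rw [← Complex.exp_sub, Complex.ofReal_exp, Complex.ofReal_exp, ← Complex.exp_add,
          ← Complex.exp_add, ← Complex.exp_add]
        congr 1
        push_cast
        ring
      have hww := wedgeIntegral_wedgeIntegral (F := F) (a := a) (φ := φp) (b := b) (ψ := φm)
        (K := Real.exp (c p.1 * p.2) * Real.exp (-(c q.1 * q.2)) *
          (C p.1 * Real.exp (-κ * p.2) * (C' q.1 * Real.exp (-κ * q.2)) * K)) ?_ fun r r' => ?_
      · rw [hww, mul_add, add_div]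
        congr 1
        · simp only [div_eq_mul_inv, ← Complex.ofReal_inv, ← Real.exp_neg, ← Complex.ofReal_mul,
            zero_add]
        · rw [mul_neg, ← neg_mul, div_eq_mul_inv, mul_right_comm, ← mul_assoc,
            ← integral_const_mul]
          refine integral_congr_ae (Eventually.of_forall fun t => ?_)
          simp only [hFe, α, β]
          have h1 : (Real.exp (-c p.1 * p.2) : ℂ) * (Real.exp (c p.1 * p.2) : ℂ) = 1 := by
            rw [← Complex.ofReal_mul, ← Real.exp_add]; simp
          have h2 : ((Real.exp (-c q.1 * q.2) : ℂ))⁻¹ * (Real.exp (-(c q.1 * q.2)) : ℂ) = 1 := by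
            rw [← neg_mul, inv_mul_cancel₀ (by simp)]
          have h3 : (Real.exp (t.2 ^ 2 - t.1 ^ 2) : ℂ) * (Real.exp (t.1 ^ 2 - t.2 ^ 2) : ℂ) = 1 := by
            rw [← Complex.ofReal_mul, ← Real.exp_add]; simp
          set X := k₀ * contourFactor τ c (-1) b φm p t.2 * contourFactor τ c 1 a φp q t.1 *
            Q t.1 t.2 * (brokenLineDeriv φp t.1 * brokenLineDeriv φm t.2)
          calc _ = X * ((Real.exp (-c p.1 * p.2) : ℂ) * (Real.exp (c p.1 * p.2) : ℂ)) *
                (((Real.exp (-c q.1 * q.2) : ℂ))⁻¹ * (Real.exp (-(c q.1 * q.2)) : ℂ)) := by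
                simp only [X]; ring
            _ = X * ((Real.exp (t.2 ^ 2 - t.1 ^ 2) : ℂ) * (Real.exp (t.1 ^ 2 - t.2 ^ 2) : ℂ)) := by
                rw [h1, h2, h3]; ring
            _ = _ := by simp only [X]; ring
      · simp only [hFe]
        exact ((((measurable_contourFactor_apply τ c (-1) b φm p).comp measurable_snd).mul
          ((measurable_contourFactor_apply τ c 1 a φp q).comp measurable_fst)).mul hQm).const_mul _
      · rw [hFe, norm_mul, norm_mul, Complex.norm_real, Complex.norm_real,
          Real.norm_of_nonneg (Real.exp_pos _).le, Real.norm_of_nonneg (Real.exp_pos _).le,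
          mul_assoc _ _ (Real.exp (-r ^ 2) * Real.exp (-r' ^ 2))]
        exact mul_le_mul_of_nonneg_left (norm_mul_mul_le_gaussian
          (mul_nonneg (hC0 _) (Real.exp_pos _).le) (mul_nonneg (hC0' _) (Real.exp_pos _).le) hK0
          (hC r' p hcut.1) (hC' r q hcut.2) (hK r r')) (by positivity)
    · simp [cutKernel, hcut]
  · simp only [α, norm_mul, norm_brokenLineDeriv, Complex.norm_real, one_mul,
      Real.norm_of_nonneg (Real.exp_pos _).le]
    calc _ ≤ C p.1 * Real.exp (-κ * p.2) * Real.exp (-(3 * t.2 ^ 2)) *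
          Real.exp (t.2 ^ 2 - t.1 ^ 2) := by gcongr; exact hC t.2 p h
      _ = C p.1 * Real.exp (-κ * p.2) *
          Real.exp (-(3 * t.2 ^ 2) + (t.2 ^ 2 - t.1 ^ 2)) := by rw [Real.exp_add]; ring
      _ ≤ _ := by
        have := hC0 p.1
        rw [← Real.exp_add]
        gcongr ?_ * Real.exp ?_
        nlinarith [sq_nonneg t.2]
  · simp only [β, norm_mul, norm_brokenLineDeriv, Complex.norm_real, one_mul,
      Real.norm_of_nonneg (Real.exp_pos _).le]
    calc _ ≤ C' p.1 * Real.exp (-κ * p.2) * Real.exp (-(3 * t.1 ^ 2)) *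
          (‖k₀‖ * (K * Real.exp (t.1 ^ 2)) * Real.exp (t.1 ^ 2 - t.2 ^ 2)) := by
          gcongr
          · have := hC0' p.1; positivity
          · exact hC' t.1 p h
          · exact hK t.1 t.2
      _ = ‖k₀‖ * K * C' p.1 * Real.exp (-κ * p.2) *
          Real.exp (-(3 * t.1 ^ 2) + (t.1 ^ 2 + (t.1 ^ 2 - t.2 ^ 2))) := by
          rw [Real.exp_add, Real.exp_add]; ring
      _ = _ := by
        rw [← Real.exp_add]
        congr 2; ring

end ContourForm
end AiryTransition

theorem mainTheorem2 (m : ℕ) (τ s : Fin m → ℝ) (hτ : StrictMono τ) :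
    (∀ a b φp φm : ℝ, -a < b → b < a →
      φp ∈ Set.Ioo (Real.pi / 3) (Real.pi / 2) →
      φm ∈ Set.Ioo (Real.pi / 2) (Real.pi - φp) →
      AiryTransition.FredholmDetWellDefined (AiryTransition.spaceMeasure m)
        (AiryTransition.cutKernel τ s (AiryTransition.contourKernel a b φp φm))) ∧
    (∀ σ : ℝ, σ = 1 ∨ σ = -1 →
      AiryTransition.FredholmDetWellDefined (AiryTransition.spaceMeasure m)
        (AiryTransition.cutKernel τ s (AiryTransition.airyKernel σ))) :=
  ⟨fun _ _ _ _ hab hba hp hm =>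
    AiryTransition.fredholmDetWellDefined_contourKernel s hτ hab hba hp hm,
    fun σ _ => AiryTransition.fredholmDetWellDefined_airyKernel s hτ σ⟩
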